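/- **Setting.** A *random rooted tree* $\mathsf T$ is a random locally finite tree with labelled vertices and root ø; $\mathsf T(k)$ denotes the subtree of its first $k$ generations (generation $0$ is the root), $|\mathsf T(k)|$ its number of vertices, $\partial\mathsf T(k)$ the set of vertices at generation $k$, and $\Delta_j$ the number of offspring of the vertex $j$. It is *conditionally independent with average offspring numbers bounded by* $\Delta<\infty$ if for each integer $k\ge 0$, conditionally on $\mathsf T(k)$, the numbers $\Delta_j$, $j\in\partial\mathsf T(k)$, are independent of each other and have conditional means at most the nonrandom constant $\Delta$. Given an inverse temperature $\beta\ge 0$ and real (possibly random) magnetic fields $B_i$, the Ising models on $\mathsf T(\ell)$ with free and with plus boundary conditions are the probability measures on $\underline x\in\{+1,-1\}^{\mathsf T(\ell)}$ $$\mu^{\ell,0}(\underline x)=\frac1{Z^{\ell,0}}\exp\Big\{\beta\sum_{(ij)\in\mathsf T(\ell)}x_ix_j+\sum_{i\in\mathsf T(\ell)}B_ix_i\Big\},$$ $$\mu^{\ell,+}(\underline x)=\frac1{Z^{\ell,+}}\exp\Big\{\beta\sum_{(ij)\in\mathsf T(\ell)}x_ix_j+\sum_{i\in\mathsf T(\ell)}B_ix_i\Big\}\,\mathbb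 I\big(x_i=+1\ \forall i\in\partial\mathsf T(\ell)\big),$$ the sums over $(ij)$ being over edges. Let $\langle\cdot\rangle^{(\ell)}_{ø}$ denote the expectation with respect to $\mu^{\ell,0}$ and $\langle x;y\rangle=\langle xy\rangle-\langle x\rangle\langle y\rangle$. For a set $U$ of vertices, $\mu_U$ denotes the marginal of $\mu$ on $\{x_i: i\in U\}$, and $\|\cdot\|_{\mathrm{TV}}$ is the total variation distance. $\mathbb E$ is the expectation over the random tree (and fields). **Statement.** For all finite $\beta_{\max}$ and $B_{\max}$ there is a finite constant $C=C(\beta_{\max},B_{\max})>0$, and for all $0<B_{\min}\le B_{\max}$ and all finite $\Delta$ there are a finite $A>0$ and a $\lambda>0$, depending only on $\beta_{\max},B_{\min},B_{\max}$ and $\Delta$, such that the following holds for every conditionally independent tree $\mathsf T$ with average offspring numbers bounded by $\Delta$ and every $0\le\beta\le\beta_{\max}$. 1. If $r\le\ell$ and $B_i\ge B_{\min}$ for all $i\in\mathsf T(\ell)$, then $\sum_{i\in\partial\mathsf T(r)}\langle x_{ø};x_i\rangle^{(\ell)}_{ø}$ is integrable and $$\mathbb E\Big\{\sum_{i\in\partial\mathsf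 T(r)}\langle x_{ø};x_i\rangle^{(\ell)}_{ø}\Big\}\le A\,e^{-\lambda r}.$$ 2. If $r<\ell$, $B_i\ge B_{\min}$ for all $i\in\mathsf T(\ell)$ and $B_i\le B_{\max}$ for all $i\in\mathsf T(\ell-1)$, then for every (possibly random) $U\subseteq\mathsf T(r)$, $$\mathbb E\,\big\|\mu_U^{\ell,+}-\mu_U^{\ell,0}\big\|_{\mathrm{TV}}\le A\,e^{-\lambda(\ell-r)}\;\mathbb E\big\{C^{|\mathsf T(r)|}\big\},$$ where the right-hand side may be infinite. -/

import Mathlib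

open MeasureTheory ProbabilityTheory
open scoped ENNReal

/-- A locally finite rooted tree with labelled vertices, realised as a subtree of the tree of all
finite words over `ℕ`. The root is the empty word, the parent of the word `a :: v` is `v`, and the
generation of a vertex is the length of the word. The tree may be finite or infinite. -/
structure WordTree where
  carrier : Set (List ℕ)
  root_mem : [] ∈ carrier
  parent_mem : ∀ (a : ℕ) (v : List ℕ), a :: v ∈ carrier → v ∈ carrier
  finite_children : ∀ v : List ℕ, {a : ℕ | a :: v ∈ carrier}.Finite

namespace WordTree

/-- The number of offspring of the vertex `v`. -/
noncomputable def offspring (T : WordTree) (v : List ℕ) : ℕ :=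
  {a : ℕ | a :: v ∈ T.carrier}.ncard

theorem finite_upTo (T : WordTree) (n : ℕ) :
    {v : List ℕ | v ∈ T.carrier ∧ v.length ≤ n}.Finite := by
  induction n with
  | zero =>
    refine (Set.finite_singleton ([] : List ℕ)).subset ?_
    rintro v ⟨-, hv⟩
    exact List.eq_nil_of_length_eq_zero (Nat.le_zero.mp hv)
  | succ n ih =>
    refine ((Set.finite_singleton ([] : List ℕ)).union
      (ih.biUnion fun v _ => (T.finite_children v).image fun a => a :: v)).subset ?_
    rintro v ⟨hv, hl⟩
    cases v with
    | nil => exact Or.inl rfl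
    | cons a w =>
      refine Or.inr (Set.mem_biUnion (x := w) ⟨T.parent_mem a w hv, ?_⟩ ⟨a, hv, rfl⟩)
      simpa using hl

/-- `T.upTo n` is the (finite) vertex set of the subtree of the first `n` generations of `T`. -/
noncomputable def upTo (T : WordTree) (n : ℕ) : Finset (List ℕ) :=
  (T.finite_upTo n).toFinset

theorem mem_upTo (T : WordTree) (n : ℕ) (v : List ℕ) :
    v ∈ T.upTo n ↔ v ∈ T.carrier ∧ v.length ≤ n := by
  simp [upTo]

/-- The root, as a vertex of the first `n` generations. -/
noncomputable def root (T : WordTree) (n : ℕ) : T.upTo n :=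
  ⟨[], (T.mem_upTo n []).2 ⟨T.root_mem, Nat.zero_le n⟩⟩

/-- Spin configurations on the first `n` generations; `ℤˣ = {1, -1}`. -/
abbrev Config (T : WordTree) (n : ℕ) : Type := T.upTo n → ℤˣ

/-- The real value `±1` of a spin. -/
def spin (s : ℤˣ) : ℝ := ((s : ℤ) : ℝ)

open Classical in
/-- The Boltzmann weight
`exp (β ∑_{(ij)} x_i x_j + ∑_i B_i x_i)` on the first `n` generations, the first sum being over the
edges, that is, over the pairs (parent, child). -/
noncomputable def freeWeight (T : WordTree) (n : ℕ) (β : ℝ) (B : List ℕ → ℝ)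
    (x : T.Config n) : ℝ :=
  Real.exp
    (β * (∑ p ∈ Finset.univ.filter (fun p : T.upTo n × T.upTo n =>
        ∃ a : ℕ, (p.2 : List ℕ) = a :: (p.1 : List ℕ)), spin (x p.1) * spin (x p.2))
      + ∑ i : T.upTo n, B i * spin (x i))

open Classical in
/-- The Boltzmann weight with plus boundary condition at generation `n`. -/
noncomputable def plusWeight (T : WordTree) (n : ℕ) (β : ℝ) (B : List ℕ → ℝ)
    (x : T.Config n) : ℝ :=
  if ∀ i : T.upTo n, (i : List ℕ).length = n → x i = 1 then T.freeWeight n β B x else 0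

/-- The Ising model on the first `n` generations with free boundary condition. -/
noncomputable def freeIsing (T : WordTree) (n : ℕ) (β : ℝ) (B : List ℕ → ℝ)
    (x : T.Config n) : ℝ :=
  T.freeWeight n β B x / ∑ y : T.Config n, T.freeWeight n β B y

/-- The Ising model on the first `n` generations with plus boundary condition. -/
noncomputable def plusIsing (T : WordTree) (n : ℕ) (β : ℝ) (B : List ℕ → ℝ)
    (x : T.Config n) : ℝ :=
  T.plusWeight n β B x / ∑ y : T.Config n, T.plusWeight n β B y

end WordTree

/-- The expectation `⟨f⟩` of `f` under the distribution `p` on a finite set. -/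
def finExpect {X : Type*} [Fintype X] (p : X → ℝ) (f : X → ℝ) : ℝ := ∑ x, p x * f x

/-- The centered correlation `⟨f; g⟩ = ⟨f g⟩ - ⟨f⟩ ⟨g⟩`. -/
def finCorr {X : Type*} [Fintype X] (p : X → ℝ) (f g : X → ℝ) : ℝ :=
  finExpect p (fun x => f x * g x) - finExpect p f * finExpect p g

/-- The total variation distance of two distributions on a finite set. -/
noncomputable def finTV {X : Type*} [Fintype X] (p q : X → ℝ) : ℝ := (∑ x, |p x - q x|) / 2

open Classical in
/-- The marginal on `U` of a distribution on spin configurations on `S` (for `U ⊆ S`). -/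
noncomputable def spinMarginal {S : Finset (List ℕ)} (p : (S → ℤˣ) → ℝ) (U : Finset (List ℕ))
    (y : U → ℤˣ) : ℝ :=
  ∑ x : S → ℤˣ with ∀ (v : List ℕ) (hS : v ∈ S) (hU : v ∈ U), x ⟨v, hS⟩ = y ⟨v, hU⟩, p x

open Classical in
/-- `∑_{i ∈ ∂T(r)} ⟨x_ø; x_i⟩` for the free Ising model on the first `n` generations, where
`∂T(r)` is the set of vertices at generation `r ≤ n`. -/
noncomputable def WordTree.corrSum (T : WordTree) (n r : ℕ) (β : ℝ) (B : List ℕ → ℝ) : ℝ :=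
  ∑ i ∈ Finset.univ.filter (fun i : T.upTo n => (i : List ℕ).length = r),
    finCorr (T.freeIsing n β B)
      (fun x => WordTree.spin (x (T.root n))) (fun x => WordTree.spin (x i))

/-- The random tree `T` is conditionally independent with average offspring numbers bounded by `Δ`:
for each `k`, conditionally on the first `k` generations (a random variable with countably many
values, so that elementary conditioning on its atoms suffices), the offspring numbers of the
vertices at generation `k` are independent, with means at most `Δ`. -/
structure IsCondIndepTree {Ω : Type*} [MeasurableSpace Ω] (P : Measure Ω) (T : Ω → WordTree)
    (Δ : ℝ) : Prop where
  measurableSet_mem : ∀ v : List ℕ, MeasurableSet {ω | v ∈ (T ω).carrier}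
  indep : ∀ (k : ℕ) (τ : Finset (List ℕ)), P {ω | (T ω).upTo k = τ} ≠ 0 →
    iIndepFun (fun (j : {v : List ℕ // v ∈ τ ∧ v.length = k}) (ω : Ω) => (T ω).offspring j)
      (cond P {ω | (T ω).upTo k = τ})
  mean_le : ∀ (k : ℕ) (τ : Finset (List ℕ)), P {ω | (T ω).upTo k = τ} ≠ 0 →
    ∀ j ∈ τ, j.length = k →
      ∫⁻ ω, ((T ω).offspring j : ℝ≥0∞) ∂(cond P {ω | (T ω).upTo k = τ}) ≤ ENNReal.ofReal Δ

/-!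
# Decay of correlations for the ferromagnetic Ising model on random trees

Summing out the generations of a tree from below, the Ising model on the first `n + k` generations
restricts to the Ising model on the first `n`, in which the field at a vertex of generation `n` is
its *cavity field*. Cavity fields obey `h v = B v + ∑ w, edgeField β (h w)`, the sum being over the
children of `v`, and along the edge to a child `w` the covariance with the root spin drops by the
factor `edgeSlope β (h w)`, the derivative of `edgeField β` at `h w`. Thus the covariance of the
root spin with a spin is at most the product of the slopes on the path between them, and
`pathSum` adds up these products. By concavity of `edgeField β` on `[0, ∞)` (`edgeField_sub_le`),
the slopes decrease in the fields, so that one may put the constant field `b = Bmin` everywhere and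
cut the tree at the generation under consideration.

Let `Q k v` be the path sum over the descendants of `v` that are `k` generations below `v`, in the
tree cut there. Concavity gives, in every tree, that `b * Q (k + 1) v` is at most the increment of
the cavity field at `v` when the tree grows from depth `k` to depth `k + 1`
(`mul_pathSum_succ_le`). These increments telescope, and each child contributes at most `β` to a
cavity field, so `∑ k ≥ 1, Q k v` is at most `β / b` times the number of children of `v`
(`sum_pathSum_le`). Applied below all vertices of generation `n`, and combined with the bound `Δ`
on the conditional mean offspring (`lintegral_pathSum_offspring_le`), this says that the numbers
`a n = 𝔼 [Q n ø]` satisfy `∑ k ≥ 1, a (n + k) ≤ M * a n` with `M = β * Δ / b`, which forces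
geometric decay (`ENNReal.le_geometric_of_tsum_le`). The same holds when the path sums start at
generation `r` and are weighted by a function of the first `r` generations.

Decay of `a` is the first assertion. For the second one, a plus boundary at generation `ℓ` changes
the cavity fields at generation `r` by at most `β` times the path sums, `ℓ - 1 - r` generations
down, of the offspring numbers (`cavity_plusField_sub_le`). Since the configuration of plus spins
has the largest weight, the total variation distance of Ising models on the first `r` generations
with these two sets of fields is at most `2 * 2 ^ |T(r)|` times the sum of the differences
(`finTV_plusIsing_freeIsing_le`).
-/

/-! ### The message function of an edge -/

/-- The field that a child with effective field `h` exerts on its parent through an edge of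
inverse temperature `β`; it equals `artanh (tanh β * tanh h)`. -/
noncomputable def edgeField (β h : ℝ) : ℝ :=
  (Real.log (Real.cosh (h + β)) - Real.log (Real.cosh (h - β))) / 2

/-- The derivative of `edgeField β`. It equals `(tanh (h + β) - tanh (h - β)) / 2`, the factor by
which the covariance with a given spin drops along an edge. -/
noncomputable def edgeSlope (β h : ℝ) : ℝ :=
  Real.sinh (2 * β) / (Real.cosh (2 * h) + Real.cosh (2 * β))

theorem two_mul_cosh_add_mul_cosh_sub (β h : ℝ) :
    2 * (Real.cosh (h + β) * Real.cosh (h - β)) = Real.cosh (2 * h) + Real.cosh (2 * β) := by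
  rw [Real.cosh_two_mul, Real.cosh_two_mul, Real.cosh_add, Real.cosh_sub]
  have h1 := Real.cosh_sq h
  have h2 := Real.cosh_sq β
  linear_combination (2 * Real.cosh β ^ 2 - 1) * h1 + (2 * Real.sinh h ^ 2 + 1) * h2

theorem edgeSlope_eq_tanh (β h : ℝ) :
    edgeSlope β h = (Real.tanh (h + β) - Real.tanh (h - β)) / 2 := by
  have hp := (Real.cosh_pos (h + β)).ne'
  have hm := (Real.cosh_pos (h - β)).ne'
  have hs : Real.sinh (2 * β) = Real.sinh (h + β) * Real.cosh (h - β)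
      - Real.cosh (h + β) * Real.sinh (h - β) := by
    rw [← Real.sinh_sub]; ring_nf
  rw [edgeSlope, ← two_mul_cosh_add_mul_cosh_sub, hs, Real.tanh_eq_sinh_div_cosh,
    Real.tanh_eq_sinh_div_cosh]
  field_simp

theorem hasDerivAt_edgeField (β h : ℝ) : HasDerivAt (edgeField β) (edgeSlope β h) h := by
  have hp := (Real.cosh_pos (h + β)).ne'
  have hm := (Real.cosh_pos (h - β)).ne'
  have h1 := (((hasDerivAt_id h).add_const β).cosh).log hp
  have h2 := (((hasDerivAt_id h).sub_const β).cosh).log hm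
  have h3 := (h1.sub h2).div_const 2
  rw [edgeSlope_eq_tanh, Real.tanh_eq_sinh_div_cosh, Real.tanh_eq_sinh_div_cosh]
  simp only [id_eq, mul_one] at h3
  exact h3

theorem edgeField_zero (β : ℝ) : edgeField β 0 = 0 := by
  simp [edgeField, Real.cosh_neg]

theorem edgeSlope_nonneg {β : ℝ} (hβ : 0 ≤ β) (h : ℝ) : 0 ≤ edgeSlope β h :=
  div_nonneg (Real.sinh_nonneg_iff.2 (by linarith))
    (add_pos (Real.cosh_pos _) (Real.cosh_pos _)).le

theorem edgeSlope_anti {β x y : ℝ} (hβ : 0 ≤ β) (hx : 0 ≤ x) (hxy : x ≤ y) :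
    edgeSlope β y ≤ edgeSlope β x := by
  have h1 : Real.cosh (2 * x) ≤ Real.cosh (2 * y) := by
    rw [Real.cosh_le_cosh, abs_of_nonneg (by linarith), abs_of_nonneg (by linarith)]
    linarith
  exact div_le_div_of_nonneg_left (Real.sinh_nonneg_iff.2 (by linarith))
    (add_pos (Real.cosh_pos _) (Real.cosh_pos _)) (by linarith)

theorem monotone_edgeField {β : ℝ} (hβ : 0 ≤ β) : Monotone (edgeField β) :=
  monotone_of_hasDerivAt_nonneg (hasDerivAt_edgeField β) (edgeSlope_nonneg hβ)

theorem edgeField_nonneg {β h : ℝ} (hβ : 0 ≤ β) (hh : 0 ≤ h) : 0 ≤ edgeField β h :=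
  edgeField_zero β ▸ monotone_edgeField hβ hh

theorem edgeField_le {β : ℝ} (hβ : 0 ≤ β) (h : ℝ) : edgeField β h ≤ β := by
  have hc : Real.cosh (h + β) ≤ Real.exp (2 * β) * Real.cosh (h - β) := by
    have e : h + β = (h - β) + 2 * β := by ring
    rw [e, Real.cosh_add, Real.cosh_eq (2 * β), Real.sinh_eq (2 * β), Real.cosh_eq (h - β),
      Real.sinh_eq (h - β)]
    have h1 : Real.exp (-(2 * β)) ≤ Real.exp (2 * β) := Real.exp_le_exp.2 (by linarith)
    nlinarith [mul_le_mul_of_nonneg_left h1 (Real.exp_pos (-(h - β))).le]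
  have hl := Real.log_le_log (Real.cosh_pos _) hc
  rw [Real.log_mul (Real.exp_pos _).ne' (Real.cosh_pos _).ne', Real.log_exp] at hl
  unfold edgeField
  linarith

/-- `edgeField β` is concave on `[0, ∞)`, so that it lies below its tangents there. -/
theorem edgeField_sub_le {β x y : ℝ} (hβ : 0 ≤ β) (hx : 0 ≤ x) (hy : 0 ≤ y) :
    edgeField β y - edgeField β x ≤ edgeSlope β x * (y - x) := by
  have hc : Continuous (edgeField β) :=
    continuous_iff_continuousAt.2 fun z => (hasDerivAt_edgeField β z).continuousAt
  rcases lt_trichotomy x y with h | rfl | h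
  · obtain ⟨c, hc1, hc2⟩ := exists_hasDerivAt_eq_slope (edgeField β) (edgeSlope β) h
      hc.continuousOn fun z _ => hasDerivAt_edgeField β z
    rw [eq_div_iff (by linarith)] at hc2
    rw [← hc2]
    exact mul_le_mul_of_nonneg_right (edgeSlope_anti hβ hx hc1.1.le) (by linarith)
  · simp
  · obtain ⟨c, hc1, hc2⟩ := exists_hasDerivAt_eq_slope (edgeField β) (edgeSlope β) h
      hc.continuousOn fun z _ => hasDerivAt_edgeField β z
    rw [eq_div_iff (by linarith)] at hc2
    have := mul_le_mul_of_nonneg_right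
      (edgeSlope_anti hβ (hy.trans hc1.1.le) hc1.2.le) (sub_nonneg.2 h.le)
    linarith

/-- Summing out a leaf spin multiplies the weight by `exp (edgeField β h * x)` up to a constant
that does not depend on the spin `x = ±1` of its parent. -/
theorem two_mul_cosh_add_spin (β h : ℝ) (x : ℤˣ) :
    2 * Real.cosh (h + β * WordTree.spin x) =
      2 * Real.exp ((Real.log (Real.cosh (h + β)) + Real.log (Real.cosh (h - β))) / 2) *
        Real.exp (edgeField β h * WordTree.spin x) := by
  rw [mul_assoc, ← Real.exp_add]
  rcases Int.units_eq_one_or x with rfl | rfl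
  · rw [show (Real.log (Real.cosh (h + β)) + Real.log (Real.cosh (h - β))) / 2 +
      edgeField β h * WordTree.spin 1 = Real.log (Real.cosh (h + β)) by
        simp [edgeField, WordTree.spin]; ring, Real.exp_log (Real.cosh_pos _)]
    simp [WordTree.spin]
  · rw [show (Real.log (Real.cosh (h + β)) + Real.log (Real.cosh (h - β))) / 2 +
      edgeField β h * WordTree.spin (-1) = Real.log (Real.cosh (h - β)) by
        simp [edgeField, WordTree.spin]; ring, Real.exp_log (Real.cosh_pos _)]
    simp [WordTree.spin, sub_eq_add_neg]

/-- The conditional mean of a leaf spin is an affine function of the spin `x = ±1` of its parent,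
with slope `edgeSlope β h`. -/
theorem sinh_add_spin (β h : ℝ) (x : ℤˣ) :
    Real.sinh (h + β * WordTree.spin x) =
      ((Real.tanh (h + β) + Real.tanh (h - β)) / 2 + edgeSlope β h * WordTree.spin x) *
        Real.cosh (h + β * WordTree.spin x) := by
  rw [edgeSlope_eq_tanh, Real.tanh_eq_sinh_div_cosh, Real.tanh_eq_sinh_div_cosh]
  have hp := (Real.cosh_pos (h + β)).ne'
  have hm := (Real.cosh_pos (h - β)).ne'
  rcases Int.units_eq_one_or x with rfl | rfl
  · simp only [WordTree.spin, Units.val_one, Int.cast_one, mul_one]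
    field_simp; ring
  · simp only [WordTree.spin, Units.val_neg, Units.val_one, Int.cast_neg, Int.cast_one, mul_neg,
      mul_one, ← sub_eq_add_neg]
    field_simp; ring

/-! ### Cavity fields and path sums on a deterministic tree -/

namespace WordTree

/-- The labels of the children of the vertex `v`. -/
noncomputable def children (T : WordTree) (v : List ℕ) : Finset ℕ := (T.finite_children v).toFinset

theorem mem_children {T : WordTree} {v : List ℕ} {a : ℕ} :
    a ∈ T.children v ↔ a :: v ∈ T.carrier := by
  simp [children]

theorem offspring_eq_card (T : WordTree) (v : List ℕ) : T.offspring v = (T.children v).card :=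
  Set.ncard_eq_toFinset_card _ (T.finite_children v)

/-- The vertices of generation `n`. -/
noncomputable def level (T : WordTree) (n : ℕ) : Finset (List ℕ) :=
  (T.upTo n).filter fun v => v.length = n

theorem mem_level {T : WordTree} {n : ℕ} {v : List ℕ} :
    v ∈ T.level n ↔ v ∈ T.carrier ∧ v.length = n := by
  simp only [level, Finset.mem_filter, mem_upTo]
  constructor
  · rintro ⟨⟨h, -⟩, h'⟩; exact ⟨h, h'⟩
  · rintro ⟨h, h'⟩; exact ⟨⟨h, h'.le⟩, h'⟩

theorem sum_level_succ {M : Type*} [AddCommMonoid M] (T : WordTree) (n : ℕ) (f : List ℕ → M) :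
    ∑ v ∈ T.level (n + 1), f v = ∑ v ∈ T.level n, ∑ a ∈ T.children v, f (a :: v) := by
  rw [Finset.sum_sigma']
  symm
  refine Finset.sum_bij (fun p _ => p.2 :: p.1) ?_ ?_ ?_ ?_
  · rintro ⟨v, a⟩ h
    simp only [Finset.mem_sigma, mem_level, mem_children] at h ⊢
    exact ⟨h.2, by simp [h.1.2]⟩
  · rintro ⟨v, a⟩ - ⟨w, b⟩ - h
    obtain ⟨rfl, rfl⟩ := List.cons.inj h
    rfl
  · rintro w hw
    rw [mem_level] at hw
    cases w with
    | nil => simp at hw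
    | cons a v =>
      exact ⟨⟨v, a⟩, by
        simpa [mem_level, mem_children, hw.1, T.parent_mem a v hw.1] using hw.2, rfl⟩
  · intros; rfl

theorem level_zero (T : WordTree) : T.level 0 = {[]} := by
  ext v
  simp only [mem_level, List.length_eq_zero_iff, Finset.mem_singleton]
  exact ⟨fun h => h.2, fun h => ⟨h ▸ T.root_mem, h⟩⟩

/-- The effective field at `v` of the Ising model on the first `k` generations of the subtree of
descendants of `v`, with fields `B`: the marginal of the spin at `v` has mean
`tanh (T.cavity β B k v)`. -/
noncomputable def cavity (T : WordTree) (β : ℝ) (B : List ℕ → ℝ) : ℕ → List ℕ → ℝ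
  | 0, v => B v
  | k + 1, v => B v + ∑ a ∈ T.children v, edgeField β (T.cavity β B k (a :: v))

/-- The sum of `f u` over the descendants `u` of `v` that are `n` generations below `v`, weighted
by the product of the slopes `edgeSlope` along the path from `v` to `u`. The slopes are those of
the tree with constant field `b`, cut `n` generations below `v`. -/
noncomputable def pathSum (T : WordTree) (β b : ℝ) : ℕ → (List ℕ → ℝ) → List ℕ → ℝ
  | 0, f, v => f v
  | n + 1, f, v => ∑ a ∈ T.children v,
      edgeSlope β (T.cavity β (fun _ => b) n (a :: v)) * T.pathSum β b n f (a :: v)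

variable {T T' : WordTree} {β b : ℝ} {B B' : List ℕ → ℝ}

theorem cavity_nonneg (hβ : 0 ≤ β) (k : ℕ) : ∀ v ∈ T.carrier,
    (∀ w ∈ T.carrier, w.length ≤ v.length + k → 0 ≤ B w) → 0 ≤ T.cavity β B k v := by
  induction k with
  | zero => exact fun v hv hB => hB v hv le_rfl
  | succ k ih =>
    intro v hv hB
    refine add_nonneg (hB v hv (by omega)) (Finset.sum_nonneg fun a ha => ?_)
    refine edgeField_nonneg hβ (ih _ (mem_children.1 ha) fun w hw hl => hB w hw ?_)
    simp only [List.length_cons] at hl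
    omega

/-- Cavity fields grow with the external fields and with the depth of the tree. -/
theorem cavity_mono (hβ : 0 ≤ β) (k m : ℕ) : ∀ v ∈ T.carrier,
    (∀ w ∈ T.carrier, w.length ≤ v.length + k → B w ≤ B' w) →
    (∀ w ∈ T.carrier, w.length ≤ v.length + (k + m) → 0 ≤ B' w) →
    T.cavity β B k v ≤ T.cavity β B' (k + m) v := by
  induction k with
  | zero =>
    intro v hv h h0
    refine (h v hv le_rfl).trans ?_
    rw [Nat.zero_add]
    cases m with
    | zero => exact le_rfl
    | succ m =>
      refine le_add_of_nonneg_right (Finset.sum_nonneg fun a ha => edgeField_nonneg hβ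
        (cavity_nonneg hβ _ _ (mem_children.1 ha) fun w hw hl => h0 w hw ?_))
      simp only [List.length_cons] at hl
      omega
  | succ k ih =>
    intro v hv h h0
    rw [show k + 1 + m = (k + m) + 1 by ring]
    refine add_le_add (h v hv (by omega)) (Finset.sum_le_sum fun a ha => ?_)
    refine monotone_edgeField hβ (ih _ (mem_children.1 ha) (fun w hw hl => h w hw ?_)
      fun w hw hl => h0 w hw ?_) <;>
    · simp only [List.length_cons] at hl
      omega

theorem cavity_const_nonneg (hβ : 0 ≤ β) (hb : 0 < b) (k : ℕ) {v : List ℕ} (hv : v ∈ T.carrier) :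
    0 ≤ T.cavity β (fun _ => b) k v :=
  cavity_nonneg hβ k v hv fun _ _ _ => hb.le

theorem pathSum_nonneg (hβ : 0 ≤ β) {f : List ℕ → ℝ} (hf : ∀ u, 0 ≤ f u) (n : ℕ) :
    ∀ v, 0 ≤ T.pathSum β b n f v := by
  induction n with
  | zero => exact hf
  | succ n ih =>
    exact fun v => Finset.sum_nonneg fun a _ => mul_nonneg (edgeSlope_nonneg hβ _) (ih _)

theorem pathSum_mono (hβ : 0 ≤ β) {f g : List ℕ → ℝ} (hfg : ∀ u ∈ T.carrier, f u ≤ g u) (n : ℕ) :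
    ∀ v ∈ T.carrier, T.pathSum β b n f v ≤ T.pathSum β b n g v := by
  induction n with
  | zero => exact hfg
  | succ n ih =>
    exact fun v _ => Finset.sum_le_sum fun a ha =>
      mul_le_mul_of_nonneg_left (ih _ (mem_children.1 ha)) (edgeSlope_nonneg hβ _)

theorem pathSum_const_mul (c : ℝ) (f : List ℕ → ℝ) (n : ℕ) :
    ∀ v, T.pathSum β b n (fun u => c * f u) v = c * T.pathSum β b n f v := by
  induction n with
  | zero => exact fun v => rfl
  | succ n ih =>
    intro v
    simp only [pathSum, ih, Finset.mul_sum]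
    exact Finset.sum_congr rfl fun a _ => by ring

theorem pathSum_sum {ι : Type*} (s : Finset ι) (f : ι → List ℕ → ℝ) (n : ℕ) :
    ∀ v, T.pathSum β b n (fun u => ∑ i ∈ s, f i u) v = ∑ i ∈ s, T.pathSum β b n (f i) v := by
  induction n with
  | zero => exact fun v => rfl
  | succ n ih =>
    intro v
    simp only [pathSum, ih, Finset.mul_sum]
    exact Finset.sum_comm

/-- Cutting the tree in the middle of the paths only increases the slopes above the cut. -/
theorem pathSum_add_le (hβ : 0 ≤ β) (hb : 0 < b) {f : List ℕ → ℝ} (hf : ∀ u, 0 ≤ f u) (n k : ℕ) :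
    ∀ v ∈ T.carrier, T.pathSum β b (n + k) f v ≤ T.pathSum β b n (T.pathSum β b k f) v := by
  induction n with
  | zero => intro v _; rw [Nat.zero_add]; exact le_rfl
  | succ n ih =>
    intro v hv
    rw [show n + 1 + k = (n + k) + 1 by ring]
    refine Finset.sum_le_sum fun a ha => mul_le_mul ?_ (ih _ (mem_children.1 ha))
      (pathSum_nonneg hβ hf _ _) (edgeSlope_nonneg hβ _)
    exact edgeSlope_anti hβ (cavity_const_nonneg hβ hb _ (mem_children.1 ha))
      (cavity_mono hβ n k _ (mem_children.1 ha) (fun _ _ _ => le_rfl) fun _ _ _ => hb.le)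

/-- By concavity of `edgeField`, the increment of the cavity field when the tree grows by one
generation controls the derivative with respect to the fields of the last generation. -/
theorem mul_pathSum_succ_le (hβ : 0 ≤ β) (hb : 0 < b) (k : ℕ) : ∀ v ∈ T.carrier,
    b * T.pathSum β b (k + 1) (fun _ => 1) v ≤
      T.cavity β (fun _ => b) (k + 1) v - T.cavity β (fun _ => b) k v := by
  induction k with
  | zero =>
    intro v hv
    simp only [pathSum, cavity, mul_one, add_sub_cancel_left, Finset.mul_sum]
    refine Finset.sum_le_sum fun a _ => ?_
    -- The tangent at `b` evaluated at the origin.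
    have := edgeField_sub_le hβ hb.le (le_refl 0)
    rw [edgeField_zero] at this
    linarith
  | succ k ih =>
    intro v hv
    have e : T.cavity β (fun _ => b) (k + 1 + 1) v - T.cavity β (fun _ => b) (k + 1) v =
        ∑ a ∈ T.children v, (edgeField β (T.cavity β (fun _ => b) (k + 1) (a :: v)) -
          edgeField β (T.cavity β (fun _ => b) k (a :: v))) := by
      rw [Finset.sum_sub_distrib]
      simp only [cavity]
      ring
    rw [e, pathSum, Finset.mul_sum]
    refine Finset.sum_le_sum fun a ha => ?_
    have hav := mem_children.1 ha
    have h1 := edgeField_sub_le hβ (cavity_const_nonneg (b := b) hβ hb (k + 1) hav)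
      (cavity_const_nonneg (b := b) hβ hb k hav)
    have h2 := mul_le_mul_of_nonneg_left (ih _ hav)
      (edgeSlope_nonneg hβ (T.cavity β (fun _ => b) (k + 1) (a :: v)))
    linarith

theorem cavity_succ_le (hβ : 0 ≤ β) (k : ℕ) (v : List ℕ) :
    T.cavity β B (k + 1) v ≤ B v + β * T.offspring v := by
  rw [offspring_eq_card, mul_comm, ← nsmul_eq_mul]
  exact add_le_add_right (Finset.sum_le_card_nsmul _ _ _ fun a _ => edgeField_le hβ _) _

/-- The increments in `mul_pathSum_succ_le` telescope, and their sum is at most `β` for each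
child. -/
theorem sum_pathSum_le (hβ : 0 ≤ β) (hb : 0 < b) (K : ℕ) {v : List ℕ} (hv : v ∈ T.carrier) :
    ∑ k ∈ Finset.range K, T.pathSum β b (k + 1) (fun _ => 1) v ≤ β / b * T.offspring v := by
  have h1 : b * ∑ k ∈ Finset.range K, T.pathSum β b (k + 1) (fun _ => 1) v ≤
      T.cavity β (fun _ => b) K v - T.cavity β (fun _ => b) 0 v := by
    rw [Finset.mul_sum, ← Finset.sum_range_sub (fun k => T.cavity β (fun _ => b) k v)]
    exact Finset.sum_le_sum fun k _ => mul_pathSum_succ_le hβ hb k v hv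
  have h2 : T.cavity β (fun _ => b) K v - T.cavity β (fun _ => b) 0 v ≤ β * T.offspring v := by
    cases K with
    | zero => simpa using by positivity
    | succ K =>
      have := cavity_succ_le (T := T) (B := fun _ => b) hβ K v
      simp only [cavity] at this ⊢
      linarith
  rw [div_mul_eq_mul_div, le_div_iff₀ hb]
  linarith

/-- Path sums beyond generation `n` are, altogether, at most a multiple of the path sum of the
offspring numbers at generation `n`. -/
theorem sum_pathSum_add_le (hβ : 0 ≤ β) (hb : 0 < b) (n K : ℕ) {v : List ℕ} (hv : v ∈ T.carrier) :
    ∑ k ∈ Finset.range K, T.pathSum β b (n + (k + 1)) (fun _ => 1) v ≤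
      β / b * T.pathSum β b n (fun u => (T.offspring u : ℝ)) v := by
  rw [← pathSum_const_mul]
  refine (Finset.sum_le_sum fun k _ =>
    pathSum_add_le hβ hb (fun _ => zero_le_one) n (k + 1) v hv).trans ?_
  rw [← pathSum_sum]
  exact pathSum_mono hβ (fun u hu => sum_pathSum_le hβ hb K hu) n v hv

/-- The fields on the first `n` generations obtained by summing out the plus spins at generation
`n + 1`. -/
noncomputable def plusField (T : WordTree) (β : ℝ) (B : List ℕ → ℝ) (n : ℕ) (v : List ℕ) : ℝ :=
  if v.length = n then B v + β * T.offspring v else B v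

theorem cavity_le_cavity_plusField (hβ : 0 ≤ β) (k : ℕ) {N : ℕ} : ∀ v, v.length + k = N →
    T.cavity β B (k + 1) v ≤ T.cavity β (T.plusField β B N) k v := by
  induction k with
  | zero =>
    intro v hv
    refine (cavity_succ_le hβ 0 v).trans ?_
    simp only [cavity, plusField]
    rw [if_pos (by omega)]
  | succ k ih =>
    intro v hv
    rw [cavity.eq_2, cavity.eq_2 T β (T.plusField β B N), plusField, if_neg (by omega)]
    refine add_le_add_right (Finset.sum_le_sum fun a ha => monotone_edgeField hβ (ih _ ?_)) _
    simp only [List.length_cons]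
    omega

/-- The plus boundary changes a cavity field by at most the sum, over the paths to the boundary,
of the products of the slopes. -/
theorem cavity_plusField_sub_le (hβ : 0 ≤ β) (hb : 0 < b) (k : ℕ) {N : ℕ}
    (hB : ∀ w ∈ T.carrier, w.length ≤ N + 1 → b ≤ B w) : ∀ v ∈ T.carrier, v.length + k = N →
    T.cavity β (T.plusField β B N) k v - T.cavity β B (k + 1) v ≤
      β * T.pathSum β b k (fun u => (T.offspring u : ℝ)) v := by
  induction k with
  | zero =>
    intro v hv hl
    simp only [cavity, plusField, pathSum]
    rw [if_pos (by omega)]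
    have : 0 ≤ ∑ a ∈ T.children v, edgeField β (B (a :: v)) :=
      Finset.sum_nonneg fun a ha => edgeField_nonneg hβ
        (hb.le.trans (hB _ (mem_children.1 ha) (by simp only [List.length_cons]; omega)))
    linarith
  | succ k ih =>
    intro v hv hl
    rw [cavity.eq_2, cavity.eq_2 T β B, plusField, if_neg (by omega), add_sub_add_left_eq_sub,
      ← Finset.sum_sub_distrib, pathSum, Finset.mul_sum]
    refine Finset.sum_le_sum fun a ha => ?_
    have hav := mem_children.1 ha
    have hl' : (a :: v).length + k = N := by simp only [List.length_cons]; omega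
    have hx0 : 0 ≤ T.cavity β B (k + 1) (a :: v) :=
      cavity_nonneg hβ _ _ hav fun w hw hwl => hb.le.trans (hB w hw (by omega))
    have h1 := edgeField_sub_le hβ hx0 (hx0.trans (cavity_le_cavity_plusField hβ k _ hl'))
    refine h1.trans ((mul_le_mul_of_nonneg_left (ih _ hav hl') (edgeSlope_nonneg hβ _)).trans ?_)
    rw [mul_left_comm]
    refine mul_le_mul_of_nonneg_left (mul_le_mul_of_nonneg_right ?_
      (pathSum_nonneg hβ (fun u => Nat.cast_nonneg _) _ _)) hβ
    exact edgeSlope_anti hβ (cavity_const_nonneg hβ hb _ hav)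
      (cavity_mono hβ k 1 _ hav (fun w hw hwl => hB w hw (by omega))
        fun w hw hwl => hb.le.trans (hB w hw (by omega)))

/-! ### Dependence on the first generations only -/

theorem mem_carrier_iff_of_upTo_eq {N : ℕ} (h : T.upTo N = T'.upTo N) {v : List ℕ}
    (hv : v.length ≤ N) : v ∈ T.carrier ↔ v ∈ T'.carrier := by
  have := congrArg (v ∈ ·) h
  simpa [mem_upTo, hv] using this

theorem upTo_eq_of_le {N n : ℕ} (h : T.upTo N = T'.upTo N) (hn : n ≤ N) :
    T.upTo n = T'.upTo n := by
  ext v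
  simp only [mem_upTo, and_congr_left_iff]
  exact fun hv => mem_carrier_iff_of_upTo_eq h (hv.trans hn)

theorem level_eq_of_upTo_eq {N n : ℕ} (h : T.upTo N = T'.upTo N) (hn : n ≤ N) :
    T.level n = T'.level n := by
  rw [level, level, upTo_eq_of_le h hn]

theorem children_eq_of_upTo_eq {N : ℕ} (h : T.upTo N = T'.upTo N) {v : List ℕ}
    (hv : v.length < N) : T.children v = T'.children v := by
  ext a
  rw [mem_children, mem_children]
  exact mem_carrier_iff_of_upTo_eq h (by simpa using hv)

theorem cavity_eq_of_upTo_eq {N : ℕ} (h : T.upTo N = T'.upTo N) (k : ℕ) :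
    ∀ v : List ℕ, v.length + k ≤ N → T.cavity β B k v = T'.cavity β B k v := by
  induction k with
  | zero => intros; rfl
  | succ k ih =>
    intro v hv
    rw [cavity, cavity, children_eq_of_upTo_eq h (by omega)]
    exact congrArg _ (Finset.sum_congr rfl fun a _ => by
      rw [ih (a :: v) (by simp only [List.length_cons]; omega)])

theorem pathSum_eq_of_upTo_eq {N : ℕ} (h : T.upTo N = T'.upTo N) (n : ℕ) (f : List ℕ → ℝ) :
    ∀ v : List ℕ, v.length + n ≤ N → T.pathSum β b n f v = T'.pathSum β b n f v := by
  induction n with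
  | zero => intros; rfl
  | succ n ih =>
    intro v hv
    rw [pathSum, pathSum, children_eq_of_upTo_eq h (by omega)]
    refine Finset.sum_congr rfl fun a _ => ?_
    have hl : (a :: v).length + n ≤ N := by simp only [List.length_cons]; omega
    rw [ih _ hl, cavity_eq_of_upTo_eq h n _ hl]

end WordTree

/-! ### Sums over spin configurations -/

open Classical in
/-- The extension of a configuration on `S` to all words, by plus spins. -/
noncomputable def extendSpin {S : Finset (List ℕ)} (x : S → ℤˣ) (v : List ℕ) : ℤˣ :=
  if h : v ∈ S then x ⟨v, h⟩ else 1

/-- The sum of `Φ` over all spin configurations on `S`. -/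
noncomputable def spinSum (S : Finset (List ℕ)) (Φ : (List ℕ → ℤˣ) → ℝ) : ℝ :=
  ∑ x : S → ℤˣ, Φ (extendSpin x)

/-- `f σ` depends only on the restriction of `σ` to `S`. -/
def LocalOn (S : Finset (List ℕ)) (f : (List ℕ → ℤˣ) → ℝ) : Prop :=
  ∀ σ τ : List ℕ → ℤˣ, (∀ v ∈ S, σ v = τ v) → f σ = f τ

theorem LocalOn.mono {S S' : Finset (List ℕ)} {f : (List ℕ → ℤˣ) → ℝ} (hf : LocalOn S f)
    (h : S ⊆ S') : LocalOn S' f :=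
  fun σ τ hst => hf σ τ fun v hv => hst v (h hv)

theorem LocalOn.mul {S : Finset (List ℕ)} {f g : (List ℕ → ℤˣ) → ℝ} (hf : LocalOn S f)
    (hg : LocalOn S g) : LocalOn S fun σ => f σ * g σ :=
  fun σ τ h => by simp only [hf σ τ h, hg σ τ h]

theorem localOn_spin {S : Finset (List ℕ)} {v : List ℕ} (hv : v ∈ S) :
    LocalOn S fun σ => WordTree.spin (σ v) :=
  fun σ τ h => by simp only [h v hv]

theorem spinSum_mul_left (S : Finset (List ℕ)) (c : ℝ) (Φ : (List ℕ → ℤˣ) → ℝ) :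
    spinSum S (fun σ => c * Φ σ) = c * spinSum S Φ :=
  (Finset.mul_sum _ _ _).symm

theorem spinSum_insert {S : Finset (List ℕ)} {w : List ℕ} (hw : w ∉ S)
    (Φ : (List ℕ → ℤˣ) → ℝ) :
    spinSum (insert w S) Φ = spinSum S fun σ => ∑ s : ℤˣ, Φ (Function.update σ w s) := by
  unfold spinSum
  rw [← Fintype.sum_prod_type']
  refine Fintype.sum_equiv (ι := ↥(insert w S) → ℤˣ) (κ := (S → ℤˣ) × ℤˣ)
    { toFun := fun x => (fun v => x ⟨v, Finset.mem_insert_of_mem v.2⟩,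
        x ⟨w, Finset.mem_insert_self w S⟩)
      invFun := fun p v => if h : (v : List ℕ) ∈ S then p.1 ⟨v, h⟩ else p.2
      left_inv := ?_
      right_inv := ?_ } _ _ ?_
  · intro x
    funext v
    by_cases h : (v : List ℕ) ∈ S
    · simp [h]
    · have : (v : List ℕ) = w := (Finset.mem_insert.1 v.2).resolve_right h
      simp only [h, dite_false]
      congr 1
      exact Subtype.ext this.symm
  · rintro ⟨x, s⟩
    simp [hw]
  · intro x
    congr 1
    funext v
    rcases eq_or_ne v w with rfl | hv
    · simp [extendSpin]
    · simp [extendSpin, hv]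

/-- Summing out the spins on a set `L` of leaves. -/
theorem spinSum_union {S L : Finset (List ℕ)} (hSL : Disjoint S L)
    (hL : ∀ w ∈ L, w.tail ∉ L) {g : (List ℕ → ℤˣ) → ℝ} (hg : LocalOn S g)
    (hS : ∀ w ∈ L, w.tail ∈ S) (F : List ℕ → ℤˣ → ℤˣ → ℝ) :
    spinSum (S ∪ L) (fun σ => g σ * ∏ w ∈ L, F w (σ w.tail) (σ w)) =
      spinSum S fun σ => g σ * ∏ w ∈ L, ∑ s : ℤˣ, F w (σ w.tail) s := by
  induction L using Finset.induction_on generalizing g with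
  | empty => simp
  | insert w L hwL ih =>
    have hwS : w ∉ S := fun h =>
      Finset.disjoint_left.1 hSL h (Finset.mem_insert_self w L)
    have hwU : w ∉ S ∪ L := by simp [hwS, hwL]
    have hwt : w.tail ≠ w := fun h =>
      hL w (Finset.mem_insert_self w L) (h.symm ▸ Finset.mem_insert_self w L)
    rw [Finset.union_insert, spinSum_insert hwU]
    have hg' : LocalOn S fun σ => g σ * ∑ s : ℤˣ, F w (σ w.tail) s :=
      hg.mul fun σ τ h => by simp only [h _ (hS w (Finset.mem_insert_self w L))]
    have := ih (Finset.disjoint_of_subset_right (Finset.subset_insert w L) hSL)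
      (fun u hu h => hL u (Finset.mem_insert_of_mem hu) (Finset.mem_insert_of_mem h)) hg'
      (fun u hu => hS u (Finset.mem_insert_of_mem hu))
    calc _ = spinSum (S ∪ L) fun σ => (g σ * ∑ s : ℤˣ, F w (σ w.tail) s) *
          ∏ u ∈ L, F u (σ u.tail) (σ u) := by
            congr 1
            funext σ
            rw [mul_assoc, mul_comm (∑ s : ℤˣ, F w (σ w.tail) s), Finset.mul_sum, Finset.mul_sum]
            refine Finset.sum_congr rfl fun s _ => ?_
            rw [Finset.prod_insert hwL]
            have e1 : g (Function.update σ w s) = g σ := hg _ _ fun v hv =>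
              Function.update_of_ne (ne_of_mem_of_not_mem hv hwS) _ _
            have e2 : ∏ u ∈ L, F u (Function.update σ w s u.tail) (Function.update σ w s u) =
                ∏ u ∈ L, F u (σ u.tail) (σ u) := Finset.prod_congr rfl fun u hu => by
              have h1 : u.tail ≠ w := fun h => hL u (Finset.mem_insert_of_mem hu)
                (h ▸ Finset.mem_insert_self w L)
              have h2 : u ≠ w := fun h => hwL (h ▸ hu)
              rw [Function.update_of_ne h1, Function.update_of_ne h2]
            rw [e1, e2, Function.update_of_ne hwt, Function.update_self]
            ring
      _ = _ := by
            rw [this]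
            congr 1
            funext σ
            rw [Finset.prod_insert hwL]
            ring

/-! ### The Ising model on a finite tree -/

/-- The exponent of the Boltzmann weight of a configuration on the parent-closed set `S` of words;
the edge to its parent is attributed to each vertex other than the root. -/
noncomputable def isingEnergy (β : ℝ) (B : List ℕ → ℝ) (S : Finset (List ℕ))
    (σ : List ℕ → ℤˣ) : ℝ :=
  ∑ v ∈ S, (B v * WordTree.spin (σ v) +
    if v = [] then 0 else β * (WordTree.spin (σ v.tail) * WordTree.spin (σ v)))

/-- The expectation of `f` under the Ising model on `S`. -/
noncomputable def isingMean (β : ℝ) (B : List ℕ → ℝ) (S : Finset (List ℕ))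
    (f : (List ℕ → ℤˣ) → ℝ) : ℝ :=
  spinSum S (fun σ => f σ * Real.exp (isingEnergy β B S σ)) /
    spinSum S fun σ => Real.exp (isingEnergy β B S σ)

theorem spinSum_exp_pos (S : Finset (List ℕ)) (E : (List ℕ → ℤˣ) → ℝ) :
    0 < spinSum S fun σ => Real.exp (E σ) :=
  Finset.sum_pos (fun _ _ => Real.exp_pos _) Finset.univ_nonempty

theorem isingMean_add (β : ℝ) (B : List ℕ → ℝ) (S : Finset (List ℕ))
    (f g : (List ℕ → ℤˣ) → ℝ) :
    isingMean β B S (fun σ => f σ + g σ) = isingMean β B S f + isingMean β B S g := by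
  rw [isingMean, isingMean, isingMean, ← add_div]
  congr 1
  simp only [spinSum, add_mul, Finset.sum_add_distrib]

theorem isingMean_const_mul (β : ℝ) (B : List ℕ → ℝ) (S : Finset (List ℕ)) (c : ℝ)
    (f : (List ℕ → ℤˣ) → ℝ) :
    isingMean β B S (fun σ => c * f σ) = c * isingMean β B S f := by
  simp only [isingMean, mul_assoc, spinSum_mul_left, mul_div_assoc]

theorem isingMean_one (β : ℝ) (B : List ℕ → ℝ) (S : Finset (List ℕ)) :
    isingMean β B S (fun _ => 1) = 1 := by
  simp only [isingMean, one_mul]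
  exact div_self (spinSum_exp_pos S _).ne'

theorem abs_isingMean_le (β : ℝ) (B : List ℕ → ℝ) (S : Finset (List ℕ))
    {f : (List ℕ → ℤˣ) → ℝ} (hf : ∀ σ, |f σ| ≤ 1) : |isingMean β B S f| ≤ 1 := by
  rw [isingMean, abs_div, abs_of_pos (spinSum_exp_pos S _), div_le_one (spinSum_exp_pos S _)]
  refine (Finset.abs_sum_le_sum_abs _ _).trans (Finset.sum_le_sum fun x _ => ?_)
  rw [abs_mul, Real.abs_exp]
  exact mul_le_of_le_one_left (Real.exp_pos _).le (hf _)

theorem spin_mul_self (s : ℤˣ) : WordTree.spin s * WordTree.spin s = 1 := by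
  rcases Int.units_eq_one_or s with rfl | rfl <;> simp [WordTree.spin]

theorem abs_spin (s : ℤˣ) : |WordTree.spin s| = 1 := by
  rcases Int.units_eq_one_or s with rfl | rfl <;> simp [WordTree.spin]

theorem sum_spin (f : ℤˣ → ℝ) : ∑ s : ℤˣ, f s = f 1 + f (-1) := by
  rw [show (Finset.univ : Finset ℤˣ) = {1, -1} from rfl, Finset.sum_pair (by decide)]

theorem sum_exp_spin (h : ℝ) : ∑ s : ℤˣ, Real.exp (h * WordTree.spin s) = 2 * Real.cosh h := by
  rw [sum_spin, Real.cosh_eq]; simp [WordTree.spin]; ring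

theorem sum_spin_mul_exp_spin (h : ℝ) :
    ∑ s : ℤˣ, WordTree.spin s * Real.exp (h * WordTree.spin s) = 2 * Real.sinh h := by
  rw [sum_spin, Real.sinh_eq]; simp [WordTree.spin]; ring

namespace WordTree

variable {T : WordTree} {β : ℝ} {B B' : List ℕ → ℝ}

theorem tail_mem_upTo {n : ℕ} {v : List ℕ} (hv : v ∈ T.upTo n) : v.tail ∈ T.upTo n := by
  cases v with
  | nil => exact hv
  | cons a w =>
    rw [mem_upTo] at hv ⊢
    exact ⟨T.parent_mem a w hv.1, by have := hv.2; simp at this ⊢; omega⟩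

theorem upTo_subset {m n : ℕ} (h : m ≤ n) : T.upTo m ⊆ T.upTo n := fun v hv => by
  rw [mem_upTo] at hv ⊢
  exact ⟨hv.1, hv.2.trans h⟩

theorem level_subset_upTo {m n : ℕ} (h : m ≤ n) : T.level m ⊆ T.upTo n :=
  (Finset.filter_subset _ _).trans (upTo_subset h)

theorem upTo_succ (T : WordTree) (n : ℕ) : T.upTo (n + 1) = T.upTo n ∪ T.level (n + 1) := by
  ext v
  simp only [Finset.mem_union, mem_upTo, mem_level]
  constructor
  · rintro ⟨h, hl⟩
    rcases Nat.lt_or_ge n v.length with h' | h'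
    · exact Or.inr ⟨h, by omega⟩
    · exact Or.inl ⟨h, h'⟩
  · rintro (⟨h, hl⟩ | ⟨h, hl⟩) <;> exact ⟨h, by omega⟩

theorem disjoint_upTo_level (T : WordTree) (n : ℕ) : Disjoint (T.upTo n) (T.level (n + 1)) :=
  Finset.disjoint_left.2 fun v hv hv' => by
    rw [mem_upTo] at hv
    rw [mem_level] at hv'
    omega

theorem tail_mem_of_mem_level {n : ℕ} {w : List ℕ} (hw : w ∈ T.level (n + 1)) :
    w.tail ∈ T.upTo n := by
  rw [mem_level] at hw
  have := (mem_upTo T _ _).1 (tail_mem_upTo ((mem_upTo T _ _).2 ⟨hw.1, hw.2.le⟩))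
  exact (mem_upTo T _ _).2 ⟨this.1, by rw [List.length_tail]; omega⟩

theorem localOn_isingEnergy (n : ℕ) : LocalOn (T.upTo n) (isingEnergy β B (T.upTo n)) :=
  fun σ τ h => Finset.sum_congr rfl fun v hv => by rw [h v hv, h _ (tail_mem_upTo hv)]

theorem isingEnergy_upTo_succ (n : ℕ) (σ : List ℕ → ℤˣ) :
    Real.exp (isingEnergy β B (T.upTo (n + 1)) σ) = Real.exp (isingEnergy β B (T.upTo n) σ) *
      ∏ w ∈ T.level (n + 1), Real.exp ((B w + β * spin (σ w.tail)) * spin (σ w)) := by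
  rw [← Real.exp_sum, ← Real.exp_add, upTo_succ, isingEnergy,
    Finset.sum_union (disjoint_upTo_level T n)]
  congr 2
  refine Finset.sum_congr rfl fun w hw => ?_
  rw [if_neg fun h => by simp [h, mem_level] at hw]
  ring

/-- Summing out the last generation, with a weight `F` at each of its vertices. -/
theorem spinSum_upTo_succ (n : ℕ) {g : (List ℕ → ℤˣ) → ℝ} (hg : LocalOn (T.upTo n) g)
    (F : List ℕ → ℤˣ → ℤˣ → ℝ) :
    spinSum (T.upTo (n + 1)) (fun σ => g σ * ∏ w ∈ T.level (n + 1), F w (σ w.tail) (σ w)) =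
      spinSum (T.upTo n) fun σ => g σ * ∏ w ∈ T.level (n + 1), ∑ s : ℤˣ, F w (σ w.tail) s := by
  rw [upTo_succ]
  exact spinSum_union (disjoint_upTo_level T n) (fun w hw h =>
    Finset.disjoint_left.1 (disjoint_upTo_level T n) (tail_mem_of_mem_level hw) h) hg
    (fun w hw => tail_mem_of_mem_level hw) F

/-- Changing the fields at generation `n` by a sum over children multiplies the Boltzmann weight by
a product over generation `n + 1`. -/
theorem isingEnergy_add_children (n : ℕ) (e : List ℕ → ℝ) (σ : List ℕ → ℤˣ)
    (hB : ∀ v ∈ T.upTo n, B' v = B v + if v.length = n then ∑ a ∈ T.children v, e (a :: v) else 0) :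
    Real.exp (isingEnergy β B' (T.upTo n) σ) = Real.exp (isingEnergy β B (T.upTo n) σ) *
      ∏ w ∈ T.level (n + 1), Real.exp (e w * spin (σ w.tail)) := by
  rw [← Real.exp_sum, ← Real.exp_add, sum_level_succ, level, Finset.sum_filter, isingEnergy,
    isingEnergy, ← Finset.sum_add_distrib]
  congr 1
  refine Finset.sum_congr rfl fun v hv => ?_
  rw [hB v hv]
  split_ifs <;> simp [← Finset.sum_mul] <;> ring

/-- The fields on the first `n` generations for which the Ising model is the marginal of the Ising
model on the first `n + k` generations with fields `B`. -/
noncomputable def cutField (T : WordTree) (β : ℝ) (B : List ℕ → ℝ) (n k : ℕ) (v : List ℕ) : ℝ :=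
  if v.length = n then T.cavity β B k v else B v

/-- The Ising model on the first `n` generations with fields `cutField` at depth `k + 1` is the
marginal of that on the first `n + 1` generations at depth `k`. -/
theorem spinSum_cutField_succ (T : WordTree) (β : ℝ) (B : List ℕ → ℝ) (n k : ℕ) :
    ∃ K : ℝ, 0 < K ∧ ∀ g, LocalOn (T.upTo n) g →
      spinSum (T.upTo (n + 1))
        (fun σ => g σ * Real.exp (isingEnergy β (T.cutField β B (n + 1) k) (T.upTo (n + 1)) σ)) =
      K * spinSum (T.upTo n)
        (fun σ => g σ * Real.exp (isingEnergy β (T.cutField β B n (k + 1)) (T.upTo n) σ)) := by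
  refine ⟨∏ w ∈ T.level (n + 1), 2 * Real.exp ((Real.log (Real.cosh (T.cavity β B k w + β)) +
    Real.log (Real.cosh (T.cavity β B k w - β))) / 2),
    Finset.prod_pos fun _ _ => mul_pos two_pos (Real.exp_pos _), fun g hg => ?_⟩
  have h1 := spinSum_upTo_succ (T := T) n (g := fun σ => g σ *
    Real.exp (isingEnergy β (T.cutField β B (n + 1) k) (T.upTo n) σ))
    (hg.mul fun σ τ h => by simp only [localOn_isingEnergy n σ τ h])
    (fun w x s => Real.exp ((T.cutField β B (n + 1) k w + β * spin x) * spin s))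
  simp only [isingEnergy_upTo_succ n, ← mul_assoc]
  rw [h1, ← spinSum_mul_left]
  congr 1
  funext σ
  rw [isingEnergy_add_children (B := T.cutField β B (n + 1) k)
    (B' := T.cutField β B n (k + 1)) n
    (fun w => edgeField β (T.cavity β B k w))]
  · rw [show ∀ a b c d : ℝ, a * (b * (c * d)) = b * c * (a * d) by intros; ring,
      ← Finset.prod_mul_distrib]
    congr 1
    refine Finset.prod_congr rfl fun w hw => ?_
    rw [sum_exp_spin, cutField, if_pos (mem_level.1 hw).2, two_mul_cosh_add_spin]
  · intro v hv
    have hl := ((mem_upTo T n v).1 hv).2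
    rw [cutField, cutField, if_neg (show v.length ≠ n + 1 by omega)]
    split_ifs <;> simp [cavity]

theorem spinSum_cutField_add (T : WordTree) (β : ℝ) (B : List ℕ → ℝ) (n k : ℕ) :
    ∃ K : ℝ, 0 < K ∧ ∀ g, LocalOn (T.upTo n) g →
      spinSum (T.upTo (n + k)) (fun σ => g σ * Real.exp (isingEnergy β B (T.upTo (n + k)) σ)) =
      K * spinSum (T.upTo n)
        (fun σ => g σ * Real.exp (isingEnergy β (T.cutField β B n k) (T.upTo n) σ)) := by
  induction k generalizing n with
  | zero =>
    refine ⟨1, one_pos, fun g _ => ?_⟩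
    have : T.cutField β B n 0 = B := by
      funext v
      simp [cutField, cavity]
    rw [this, one_mul, add_zero]
  | succ k ih =>
    obtain ⟨K, hK, h⟩ := ih (n + 1)
    obtain ⟨K', hK', h'⟩ := spinSum_cutField_succ T β B n k
    refine ⟨K * K', mul_pos hK hK', fun g hg => ?_⟩
    rw [show n + (k + 1) = n + 1 + k by ring, h g (hg.mono (upTo_subset n.le_succ)), h' g hg,
      mul_assoc]

theorem isingMean_upTo_add (n k : ℕ) {g : (List ℕ → ℤˣ) → ℝ} (hg : LocalOn (T.upTo n) g) :
    isingMean β B (T.upTo (n + k)) g = isingMean β (T.cutField β B n k) (T.upTo n) g := by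
  obtain ⟨K, hK, h⟩ := spinSum_cutField_add T β B n k
  have h1 := h (fun _ => 1) fun _ _ _ => rfl
  simp only [one_mul] at h1
  rw [isingMean, h g hg, h1, isingMean, mul_div_mul_left _ _ hK.ne']

/-- The spin of a leaf may be replaced by its conditional mean given the spin of its parent. -/
theorem isingMean_mul_leaf (n : ℕ) {g : (List ℕ → ℤˣ) → ℝ} (hg : LocalOn (T.upTo n) g)
    {i : List ℕ} (hi : i ∈ T.level (n + 1)) :
    isingMean β B (T.upTo (n + 1)) (fun σ => g σ * spin (σ i)) =
      isingMean β B (T.upTo (n + 1)) fun σ => g σ *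
        ((Real.tanh (B i + β) + Real.tanh (B i - β)) / 2 + edgeSlope β (B i) * spin (σ i.tail)) := by
  have hw : LocalOn (T.upTo n) fun σ => Real.exp (isingEnergy β B (T.upTo n) σ) :=
    fun σ τ h => by simp only [localOn_isingEnergy n σ τ h]
  have hp : LocalOn (T.upTo n) fun σ =>
      (Real.tanh (B i + β) + Real.tanh (B i - β)) / 2 + edgeSlope β (B i) * spin (σ i.tail) :=
    fun σ τ h => by simp only [h _ (tail_mem_of_mem_level hi)]
  rw [isingMean, isingMean]
  congr 1
  have h1 := spinSum_upTo_succ n (hg.mul hw) fun w x s =>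
    (if w = i then spin s else 1) * Real.exp ((B w + β * spin x) * spin s)
  have h2 := spinSum_upTo_succ n ((hg.mul hp).mul hw) fun w x s =>
    Real.exp ((B w + β * spin x) * spin s)
  calc _ = _ := by
        congr 1
        funext σ
        rw [isingEnergy_upTo_succ]
        rw [show ∀ a b c d : ℝ, a * b * (c * d) = a * c * (b * d) by intros; ring]
        have : spin (σ i) = ∏ w ∈ T.level (n + 1), if w = i then spin (σ w) else 1 := by
          rw [Finset.prod_ite_eq' , if_pos hi]
        rw [this, ← Finset.prod_mul_distrib]
    _ = _ := h1
    _ = _ := by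
        congr 1
        funext σ
        rw [← Finset.mul_prod_erase _ _ hi, ← Finset.mul_prod_erase _ _ hi]
        have e1 : ∑ s : ℤˣ, (if i = i then spin s else 1) *
            Real.exp ((B i + β * spin (σ i.tail)) * spin s) =
            ((Real.tanh (B i + β) + Real.tanh (B i - β)) / 2 +
              edgeSlope β (B i) * spin (σ i.tail)) *
            ∑ s : ℤˣ, Real.exp ((B i + β * spin (σ i.tail)) * spin s) := by
          simp only [if_true, sum_spin_mul_exp_spin, sum_exp_spin, sinh_add_spin]
          ring
        have e2 : ∏ w ∈ (T.level (n + 1)).erase i, ∑ s : ℤˣ, (if w = i then spin s else 1) *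
            Real.exp ((B w + β * spin (σ w.tail)) * spin s) =
            ∏ w ∈ (T.level (n + 1)).erase i, ∑ s : ℤˣ,
              Real.exp ((B w + β * spin (σ w.tail)) * spin s) :=
          Finset.prod_congr rfl fun w hw => by
            simp only [if_neg (Finset.ne_of_mem_erase hw), one_mul]
        rw [e1, e2]
        ring
    _ = _ := h2.symm
    _ = _ := by
        congr 1
        funext σ
        rw [isingEnergy_upTo_succ]
        ring

/-- The covariance of the root spin and the spin at `v` under the free Ising model on the first
`n` generations. -/
noncomputable def rootCov (T : WordTree) (n : ℕ) (β : ℝ) (B : List ℕ → ℝ) (v : List ℕ) : ℝ :=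
  isingMean β B (T.upTo n) (fun σ => spin (σ []) * spin (σ v)) -
    isingMean β B (T.upTo n) (fun σ => spin (σ [])) *
      isingMean β B (T.upTo n) (fun σ => spin (σ v))

/-- The covariance with the root spin drops along an edge by the slope at the cavity field. -/
theorem rootCov_cons (n k : ℕ) {a : ℕ} {v : List ℕ} (hav : a :: v ∈ T.carrier)
    (hv : v.length = n) :
    T.rootCov (n + 1 + k) β B (a :: v) =
      edgeSlope β (T.cavity β B k (a :: v)) * T.rootCov (n + 1 + k) β B v := by
  have hl : a :: v ∈ T.level (n + 1) := mem_level.2 ⟨hav, by simp [hv]⟩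
  have hv1 : v ∈ T.upTo n := (mem_upTo T n v).2 ⟨T.parent_mem a v hav, hv.le⟩
  have h0 : [] ∈ T.upTo n := (mem_upTo T n []).2 ⟨T.root_mem, Nat.zero_le n⟩
  have hs := upTo_subset (T := T) n.le_succ
  have hl' := level_subset_upTo (T := T) le_rfl hl
  have key : ∀ g, LocalOn (T.upTo n) g →
      isingMean β B (T.upTo (n + 1 + k)) (fun σ => g σ * spin (σ (a :: v))) =
        (Real.tanh (T.cavity β B k (a :: v) + β) + Real.tanh (T.cavity β B k (a :: v) - β)) / 2 *
          isingMean β B (T.upTo (n + 1 + k)) g + edgeSlope β (T.cavity β B k (a :: v)) *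
          isingMean β B (T.upTo (n + 1 + k)) (fun σ => g σ * spin (σ v)) := by
    intro g hg
    rw [isingMean_upTo_add (n + 1) k ((hg.mono hs).mul (localOn_spin hl')),
      isingMean_upTo_add (n + 1) k (hg.mono hs),
      isingMean_upTo_add (n + 1) k ((hg.mono hs).mul (localOn_spin (hs hv1))),
      isingMean_mul_leaf n hg hl, ← isingMean_const_mul, ← isingMean_const_mul, ← isingMean_add]
    congr 1
    funext σ
    rw [cutField, if_pos (mem_level.1 hl).2, List.tail_cons]
    ring
  have k1 := key _ (localOn_spin h0)
  have k2 := key (fun _ => 1) fun _ _ _ => rfl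
  simp only [one_mul, isingMean_one] at k2
  rw [rootCov, k1, k2, rootCov]
  ring

theorem rootCov_nil_mem (n : ℕ) : T.rootCov n β B [] ∈ Set.Icc (0 : ℝ) 1 := by
  have h := abs_isingMean_le β B (T.upTo n) (f := fun σ => spin (σ [])) fun σ => (abs_spin _).le
  have h2 := (abs_le.1 h)
  simp only [rootCov, spin_mul_self, isingMean_one, Set.mem_Icc]
  constructor <;> nlinarith

theorem rootCov_nonneg (hβ : 0 ≤ β) (n : ℕ) : ∀ v ∈ T.carrier, v.length ≤ n →
    0 ≤ T.rootCov n β B v := by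
  intro v
  induction v with
  | nil => exact fun _ _ => (rootCov_nil_mem n).1
  | cons a v ih =>
    intro hav hl
    rw [List.length_cons] at hl
    obtain ⟨k, rfl⟩ := Nat.exists_eq_add_of_le hl
    rw [rootCov_cons v.length k hav rfl]
    exact mul_nonneg (edgeSlope_nonneg hβ _) (ih (T.parent_mem a v hav) (by omega))

/-- Covariances with the root decrease with the fields and with the depth of the tree, and are thus
bounded by the path sum for a constant field and a tree that ends at generation `r`. -/
theorem sum_rootCov_le {b : ℝ} (hβ : 0 ≤ β) (hb : 0 < b) {l : ℕ}
    (hB : ∀ w ∈ T.carrier, w.length ≤ l → b ≤ B w) {r : ℕ} (hr : r ≤ l) :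
    ∑ v ∈ T.level r, T.rootCov l β B v ≤ T.pathSum β b r (fun _ => 1) [] := by
  have key : ∀ m j, j + m ≤ l → ∑ v ∈ T.level (j + m), T.rootCov l β B v ≤
      ∑ v ∈ T.level j, T.rootCov l β B v * T.pathSum β b m (fun _ => 1) v := by
    intro m
    induction m with
    | zero => intro j _; simp [pathSum]
    | succ m ih =>
      intro j hj
      rw [show j + (m + 1) = j + 1 + m by ring]
      refine (ih (j + 1) (by omega)).trans ?_
      rw [sum_level_succ]
      refine Finset.sum_le_sum fun v hv => ?_
      rw [pathSum, Finset.mul_sum]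
      refine Finset.sum_le_sum fun a ha => ?_
      have hav := mem_children.1 ha
      have hvl := (mem_level.1 hv).2
      have hc : T.rootCov l β B (a :: v) ≤
          edgeSlope β (T.cavity β (fun _ => b) m (a :: v)) * T.rootCov l β B v := by
        obtain ⟨k, rfl⟩ := Nat.exists_eq_add_of_le (show j + 1 + m ≤ l by omega)
        rw [show j + 1 + m + k = j + 1 + (m + k) by ring] at hB ⊢
        rw [rootCov_cons j (m + k) hav hvl]
        refine mul_le_mul_of_nonneg_right ?_
          (rootCov_nonneg hβ _ v (T.parent_mem a v hav) (by omega))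
        refine edgeSlope_anti hβ (cavity_const_nonneg hβ hb _ hav) (cavity_mono hβ m k _ hav
          (fun w hw hl => hB w hw ?_) fun w hw hl => hb.le.trans (hB w hw ?_)) <;>
        · simp only [List.length_cons] at hl
          omega
      calc _ ≤ _ := mul_le_mul_of_nonneg_right hc (pathSum_nonneg hβ (fun _ => zero_le_one) _ _)
        _ = _ := by ring
  have := key r 0 (by omega)
  rw [Nat.zero_add, level_zero, Finset.sum_singleton] at this
  exact this.trans (mul_le_of_le_one_left (pathSum_nonneg hβ (fun _ => zero_le_one) _ _)
    (rootCov_nil_mem l).2)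

end WordTree

/-! ### Total variation distance of Ising models -/

/-- Two weights that equal `1` at a common maximal configuration are normalised by at least `1`, so
the normalised weights are as close as their exponents, up to the number of configurations. -/
theorem sum_exp_neg_div_sub_le {X : Type*} [Fintype X] {E E' f : X → ℝ} {δ : ℝ} (x₀ : X)
    (h0 : E x₀ = 0) (hE : ∀ x, 0 ≤ E x) (hE' : ∀ x, 0 ≤ E' x) (hδ : ∀ x, |E x - E' x| ≤ δ)
    (hf : ∀ x, |f x| ≤ 1) :
    (∑ x, f x * Real.exp (-E x)) / (∑ x, Real.exp (-E x)) -
      (∑ x, f x * Real.exp (-E' x)) / (∑ x, Real.exp (-E' x)) ≤ 2 * (Fintype.card X * δ) := by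
  have hd : ∀ x, |Real.exp (-E x) - Real.exp (-E' x)| ≤ δ := by
    have aux : ∀ s t : ℝ, 0 ≤ s → Real.exp (-s) - Real.exp (-t) ≤ |s - t| := by
      intro s t hs
      have h1 := Real.add_one_le_exp (s - t)
      have h2 : Real.exp (-t) = Real.exp (-s) * Real.exp (s - t) := by
        rw [← Real.exp_add]; ring_nf
      have h3 : Real.exp (-s) ≤ 1 := Real.exp_le_one_iff.2 (by linarith)
      have h4 := Real.exp_pos (-s)
      rw [h2]
      nlinarith [neg_abs_le (s - t), abs_nonneg (s - t)]
    intro x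
    refine abs_le.2 ⟨?_, (aux _ _ (hE x)).trans (hδ x)⟩
    have := (aux _ _ (hE' x)).trans ((abs_sub_comm _ _).trans_le (hδ x))
    linarith
  set Z := ∑ x, Real.exp (-E x) with hZ
  set Z' := ∑ x, Real.exp (-E' x) with hZ'
  set A := ∑ x, f x * Real.exp (-E x) with hA
  set A' := ∑ x, f x * Real.exp (-E' x) with hA'
  have hZ1 : 1 ≤ Z := by
    have := Finset.single_le_sum (fun x _ => (Real.exp_pos (-E x)).le) (Finset.mem_univ x₀)
    simpa [h0] using this
  have hZ0 : 0 < Z' := Finset.sum_pos (fun _ _ => Real.exp_pos _) ⟨x₀, Finset.mem_univ _⟩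
  have h1 : A - A' ≤ Fintype.card X * δ := by
    rw [hA, hA', ← Finset.sum_sub_distrib, ← nsmul_eq_mul]
    refine Finset.sum_le_card_nsmul _ _ _ fun x _ => ?_
    rw [← mul_sub]
    refine (le_abs_self _).trans ?_
    rw [abs_mul]
    exact (mul_le_of_le_one_left (abs_nonneg _) (hf x)).trans (hd x)
  have h2 : |Z' - Z| ≤ Fintype.card X * δ := by
    rw [hZ, hZ', ← Finset.sum_sub_distrib, ← nsmul_eq_mul]
    refine (Finset.abs_sum_le_sum_abs _ _).trans (Finset.sum_le_card_nsmul _ _ _ fun x _ => ?_)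
    rw [abs_sub_comm]
    exact hd x
  have h3 : |A' / Z'| ≤ 1 := by
    rw [abs_div, abs_of_pos hZ0, div_le_one hZ0]
    refine (Finset.abs_sum_le_sum_abs _ _).trans (Finset.sum_le_sum fun x _ => ?_)
    rw [abs_mul, Real.abs_exp]
    exact mul_le_of_le_one_left (Real.exp_pos _).le (hf x)
  have h4 : A' / Z' * (Z' - Z) ≤ Fintype.card X * δ := by
    refine (le_abs_self _).trans ?_
    rw [abs_mul]
    exact (mul_le_of_le_one_left (abs_nonneg _) h3).trans h2
  have h5 : A / Z - A' / Z' = (A - A' + A' / Z' * (Z' - Z)) / Z := by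
    field_simp
    ring
  rw [h5, div_le_iff₀ (by linarith)]
  have h6 : 0 ≤ (Fintype.card X : ℝ) * δ := (abs_nonneg _).trans h2
  nlinarith

theorem spin_le_one (s : ℤˣ) : WordTree.spin s ≤ 1 := (abs_spin s) ▸ le_abs_self _

/-- For nonnegative fields the all-plus configuration has the largest weight. Hence Ising models
with different fields are close, with a constant independent of the size of the fields. -/
theorem isingMean_sub_le {β : ℝ} (hβ : 0 ≤ β) {H H' : List ℕ → ℝ} {S : Finset (List ℕ)}
    (hH : ∀ v ∈ S, 0 ≤ H v) (hH' : ∀ v ∈ S, 0 ≤ H' v) {f : (List ℕ → ℤˣ) → ℝ}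
    (hf : ∀ σ, |f σ| ≤ 1) :
    isingMean β H S f - isingMean β H' S f ≤ 4 * 2 ^ S.card * ∑ v ∈ S, |H v - H' v| := by
  have hnorm : ∀ G : List ℕ → ℝ, isingMean β G S f =
      (∑ x : S → ℤˣ, f (extendSpin x) * Real.exp
        (-(isingEnergy β G S 1 - isingEnergy β G S (extendSpin x)))) /
      ∑ x : S → ℤˣ, Real.exp (-(isingEnergy β G S 1 - isingEnergy β G S (extendSpin x))) := by
    intro G
    have e : ∀ x : S → ℤˣ, Real.exp (-(isingEnergy β G S 1 - isingEnergy β G S (extendSpin x))) =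
        Real.exp (-isingEnergy β G S 1) * Real.exp (isingEnergy β G S (extendSpin x)) := by
      intro x; rw [← Real.exp_add]; ring_nf
    simp only [e, mul_left_comm (f _), ← Finset.mul_sum]
    rw [mul_div_mul_left _ _ (Real.exp_pos _).ne']
    rfl
  have hpos : ∀ G : List ℕ → ℝ, (∀ v ∈ S, 0 ≤ G v) → ∀ σ,
      0 ≤ isingEnergy β G S 1 - isingEnergy β G S σ := by
    intro G hG σ
    refine sub_nonneg.2 (Finset.sum_le_sum fun v hv => add_le_add ?_ ?_)
    · refine mul_le_mul_of_nonneg_left ?_ (hG v hv)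
      exact (spin_le_one _).trans_eq (by simp [WordTree.spin])
    · split_ifs
      · exact le_rfl
      · refine mul_le_mul_of_nonneg_left ?_ hβ
        rcases Int.units_eq_one_or (σ v) with h | h <;>
        rcases Int.units_eq_one_or (σ v.tail) with h' | h' <;>
        simp [WordTree.spin, h, h']
  have hext : extendSpin (fun _ : S => (1 : ℤˣ)) = 1 := by
    funext v
    simp [extendSpin]
  rw [hnorm, hnorm]
  refine (sum_exp_neg_div_sub_le (δ := 2 * ∑ v ∈ S, |H v - H' v|) (fun _ => 1) (by simp [hext])
    (fun x => hpos H hH _) (fun x => hpos H' hH' _) (fun x => ?_) (fun x => hf _)).trans_eq ?_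
  · have e : isingEnergy β H S 1 - isingEnergy β H S (extendSpin x) -
        (isingEnergy β H' S 1 - isingEnergy β H' S (extendSpin x)) =
        ∑ v ∈ S, (H v - H' v) * (1 - WordTree.spin (extendSpin x v)) := by
      simp only [isingEnergy, ← Finset.sum_sub_distrib]
      refine Finset.sum_congr rfl fun v _ => ?_
      simp only [WordTree.spin, Pi.one_apply, Units.val_one, Int.cast_one]
      ring
    rw [e, Finset.mul_sum]
    refine (Finset.abs_sum_le_sum_abs _ _).trans (Finset.sum_le_sum fun v _ => ?_)
    rw [abs_mul, mul_comm]
    refine mul_le_mul_of_nonneg_right ?_ (abs_nonneg _)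
    rcases Int.units_eq_one_or (extendSpin x v) with h | h <;> simp [WordTree.spin, h]
    norm_num
  · have hc : Fintype.card (S → ℤˣ) = 2 ^ S.card := by
      rw [Fintype.card_fun, Fintype.card_coe]
      rfl
    rw [hc]
    push_cast
    ring

/-- The total variation distance of two marginals is attained by a test function. -/
theorem exists_finTV_spinMarginal_eq {S U : Finset (List ℕ)} (hUS : U ⊆ S) (p q : (S → ℤˣ) → ℝ) :
    ∃ f : (List ℕ → ℤˣ) → ℝ, LocalOn U f ∧ (∀ σ, |f σ| ≤ 1) ∧
      finTV (spinMarginal p U) (spinMarginal q U) =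
        (finExpect p (fun x => f (extendSpin x)) - finExpect q (fun x => f (extendSpin x))) / 2 := by
  classical
  let s : (U → ℤˣ) → ℝ := fun y => SignType.sign (spinMarginal p U y - spinMarginal q U y)
  have hs : ∀ y, |s y| ≤ 1 := by
    intro y
    simp only [s]
    rcases lt_trichotomy (spinMarginal p U y - spinMarginal q U y) 0 with h | h | h
    · simp [sign_neg h]
    · simp [h]
    · simp [sign_pos h]
  have hm : ∀ p : (S → ℤˣ) → ℝ, finExpect p (fun x => s fun v : U => extendSpin x v) =
      ∑ y, s y * spinMarginal p U y := by
    intro p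
    have he : ∀ (x : S → ℤˣ) (y : U → ℤˣ), (∀ (v : List ℕ) (hS : v ∈ S) (hU : v ∈ U),
        x ⟨v, hS⟩ = y ⟨v, hU⟩) ↔ (fun v : U => extendSpin x v) = y := by
      intro x y
      constructor
      · intro h
        funext v
        simp only [extendSpin, dif_pos (hUS v.2)]
        exact h v (hUS v.2) v.2
      · rintro rfl v hS hU
        simp [extendSpin, hS]
    simp only [spinMarginal, finExpect, he, Finset.mul_sum, Finset.sum_filter]
    rw [Finset.sum_comm]
    refine Finset.sum_congr rfl fun x _ => ?_
    rw [Finset.sum_eq_single (fun v : U => extendSpin x v)]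
    · simp [mul_comm]
    · intro y _ hy
      simp [hy.symm]
    · simp
  refine ⟨fun σ => s fun v => σ v, fun σ τ h => congrArg s (funext fun v => h v v.2),
    fun σ => hs _, ?_⟩
  rw [hm, hm, ← Finset.sum_sub_distrib, finTV]
  congr 1
  refine Finset.sum_congr rfl fun y _ => ?_
  rw [← mul_sub]
  exact (sign_mul_self _).symm

namespace WordTree

variable {T : WordTree} {β b : ℝ} {B : List ℕ → ℝ}

theorem extendSpin_coe {S : Finset (List ℕ)} (x : S → ℤˣ) (v : S) : extendSpin x v = x v := by
  simp [extendSpin]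

theorem freeWeight_eq (n : ℕ) (x : T.Config n) :
    T.freeWeight n β B x = Real.exp (isingEnergy β B (T.upTo n) (extendSpin x)) := by
  classical
  rw [freeWeight, isingEnergy, Finset.sum_add_distrib, add_comm]
  congr 2
  · rw [← Finset.sum_coe_sort (T.upTo n)]
    exact Finset.sum_congr rfl fun v _ => by rw [extendSpin_coe]
  · rw [← Finset.sum_coe_sort (T.upTo n), Finset.sum_filter, Fintype.sum_prod_type_right,
      Finset.mul_sum]
    refine Finset.sum_congr rfl fun c _ => ?_
    obtain ⟨w, hw⟩ := c
    cases w with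
    | nil => simp
    | cons a u =>
      have hu : u ∈ T.upTo n := tail_mem_upTo hw
      rw [Finset.sum_eq_single (⟨u, hu⟩ : T.upTo n)]
      · simp [extendSpin, hu, hw]
      · intro d _ hd
        refine if_neg ?_
        rintro ⟨a', h⟩
        exact hd (Subtype.ext (List.cons.inj h).2.symm)
      · simp

theorem finExpect_freeIsing (n : ℕ) (f : (List ℕ → ℤˣ) → ℝ) :
    finExpect (T.freeIsing n β B) (fun x => f (extendSpin x)) = isingMean β B (T.upTo n) f := by
  simp only [finExpect, freeIsing, isingMean, spinSum, Finset.sum_div, freeWeight_eq]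
  exact Finset.sum_congr rfl fun x _ => by ring

theorem corrSum_eq {n r : ℕ} (hr : r ≤ n) :
    T.corrSum n r β B = ∑ v ∈ T.level r, T.rootCov n β B v := by
  classical
  have h0 : ∀ i : T.upTo n, finCorr (T.freeIsing n β B) (fun x => spin (x (T.root n)))
      (fun x => spin (x i)) = T.rootCov n β B i := by
    intro i
    rw [finCorr, rootCov, ← finExpect_freeIsing, ← finExpect_freeIsing, ← finExpect_freeIsing]
    have : ∀ x : T.Config n, extendSpin x [] = x (T.root n) := fun x =>
      extendSpin_coe x (T.root n)
    simp only [this, extendSpin_coe]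
  have h1 : T.level r = (T.upTo n).filter fun v => v.length = r := by
    ext v
    simp only [mem_level, Finset.mem_filter, mem_upTo]
    constructor
    · rintro ⟨h, h'⟩; exact ⟨⟨h, by omega⟩, h'⟩
    · rintro ⟨⟨h, -⟩, h'⟩; exact ⟨h, h'⟩
  simp only [corrSum, h0]
  rw [h1, Finset.sum_filter, Finset.sum_filter, ← Finset.sum_coe_sort (T.upTo n)]

/-- A plus spin at generation `N + 1` acts on its parent as an additional field `β`. -/
theorem finExpect_plusIsing (N : ℕ) {f : (List ℕ → ℤˣ) → ℝ} (hf : LocalOn (T.upTo N) f) :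
    finExpect (T.plusIsing (N + 1) β B) (fun x => f (extendSpin x)) =
      isingMean β (T.plusField β B N) (T.upTo N) f := by
  classical
  have hw : ∀ x : T.Config (N + 1), T.plusWeight (N + 1) β B x =
      Real.exp (isingEnergy β B (T.upTo N) (extendSpin x)) * ∏ w ∈ T.level (N + 1),
        (if extendSpin x w = 1 then
          Real.exp ((B w + β * spin (extendSpin x w.tail)) * spin (extendSpin x w)) else 0) := by
    intro x
    rw [plusWeight, freeWeight_eq, isingEnergy_upTo_succ]
    split_ifs with h
    · congr 1
      refine Finset.prod_congr rfl fun w hw => ?_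
      rw [if_pos]
      have hw' := level_subset_upTo (T := T) le_rfl hw
      exact (extendSpin_coe x ⟨w, hw'⟩).trans (h ⟨w, hw'⟩ (mem_level.1 hw).2)
    · push Not at h
      obtain ⟨i, hi, hx⟩ := h
      rw [Finset.prod_eq_zero (i := (i : List ℕ)), mul_zero]
      · exact mem_level.2 ⟨((mem_upTo T _ _).1 i.2).1, hi⟩
      · rw [extendSpin_coe, if_neg hx]
  have key : ∀ g, LocalOn (T.upTo N) g →
      ∑ x : T.Config (N + 1), g (extendSpin x) * T.plusWeight (N + 1) β B x =
      (∏ w ∈ T.level (N + 1), Real.exp (B w)) * spinSum (T.upTo N) fun σ =>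
        g σ * Real.exp (isingEnergy β (T.plusField β B N) (T.upTo N) σ) := by
    intro g hg
    simp only [hw]
    have h1 := spinSum_upTo_succ (T := T) N
      (g := fun σ => g σ * Real.exp (isingEnergy β B (T.upTo N) σ))
      (hg.mul fun σ τ h => by simp only [localOn_isingEnergy N σ τ h])
      (fun w x s => if s = 1 then Real.exp ((B w + β * spin x) * spin s) else 0)
    rw [← spinSum_mul_left]
    simp only [← mul_assoc]
    refine h1.trans ?_
    congr 1
    funext σ
    have e : ∏ w ∈ T.level (N + 1), (∑ s : ℤˣ, if s = 1 then
        Real.exp ((B w + β * spin (σ w.tail)) * spin s) else 0) =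
        (∏ w ∈ T.level (N + 1), Real.exp (B w)) *
          ∏ w ∈ T.level (N + 1), Real.exp (β * spin (σ w.tail)) := by
      rw [← Finset.prod_mul_distrib]
      refine Finset.prod_congr rfl fun w _ => ?_
      simp [spin, ← Real.exp_add]
    rw [e, isingEnergy_add_children (B := B) (B' := T.plusField β B N) N (fun _ => β)]
    · ring
    · intro v _
      rw [plusField, offspring_eq_card]
      split_ifs <;> simp [mul_comm]
  have k1 := key f hf
  have k2 := key (fun _ => 1) fun _ _ _ => rfl
  simp only [one_mul] at k2
  have e : finExpect (T.plusIsing (N + 1) β B) (fun x => f (extendSpin x)) =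
      (∑ x : T.Config (N + 1), f (extendSpin x) * T.plusWeight (N + 1) β B x) /
        ∑ x : T.Config (N + 1), T.plusWeight (N + 1) β B x := by
    simp only [finExpect, plusIsing, Finset.sum_div]
    exact Finset.sum_congr rfl fun x _ => by ring
  rw [e, k1, k2, mul_div_mul_left _ _ (Finset.prod_pos fun _ _ => Real.exp_pos _).ne']
  rfl

/-- The marginals on `U` differ only through the cavity fields at generation `r`, and these by at
most the path sums of `cavity_plusField_sub_le`. -/
theorem finTV_plusIsing_freeIsing_le (hβ : 0 ≤ β) (hb : 0 < b) (r k : ℕ)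
    (hB : ∀ w ∈ T.carrier, w.length ≤ r + k + 1 → b ≤ B w) {U : Finset (List ℕ)}
    (hU : U ⊆ T.upTo r) :
    finTV (spinMarginal (T.plusIsing (r + k + 1) β B) U)
        (spinMarginal (T.freeIsing (r + k + 1) β B) U) ≤
      2 * 2 ^ (T.upTo r).card *
        (β * ∑ v ∈ T.level r, T.pathSum β b k (fun u => (T.offspring u : ℝ)) v) := by
  obtain ⟨f, hfU, hf1, hf⟩ := exists_finTV_spinMarginal_eq
    (hU.trans (upTo_subset (T := T) (show r ≤ r + k + 1 by omega)))
    (T.plusIsing (r + k + 1) β B) (T.freeIsing (r + k + 1) β B)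
  have hfr := hfU.mono hU
  rw [hf, finExpect_plusIsing _ (hfr.mono (upTo_subset (by omega))), finExpect_freeIsing,
    isingMean_upTo_add r k hfr, add_assoc, isingMean_upTo_add r (k + 1) hfr]
  have hB0 : ∀ w ∈ T.carrier, w.length ≤ r + k + 1 → 0 ≤ B w := fun w hw hl =>
    hb.le.trans (hB w hw hl)
  have hp0 : ∀ w ∈ T.carrier, w.length ≤ r + k → 0 ≤ T.plusField β B (r + k) w := by
    intro w hw hl
    have := hB0 w hw (by omega)
    rw [plusField]
    split_ifs <;> positivity
  have hH : ∀ v ∈ T.upTo r, 0 ≤ T.cutField β (T.plusField β B (r + k)) r k v := by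
    intro v hv
    rw [mem_upTo] at hv
    rw [cutField]
    split_ifs with h
    · exact cavity_nonneg hβ k v hv.1 fun w hw hl => hp0 w hw (by omega)
    · exact hp0 v hv.1 (by omega)
  have hH' : ∀ v ∈ T.upTo r, 0 ≤ T.cutField β B r (k + 1) v := by
    intro v hv
    rw [mem_upTo] at hv
    rw [cutField]
    split_ifs with h
    · exact cavity_nonneg hβ (k + 1) v hv.1 fun w hw hl => hB0 w hw (by omega)
    · exact hB0 v hv.1 (by omega)
  have hsum : ∑ v ∈ T.upTo r, |T.cutField β (T.plusField β B (r + k)) r k v -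
      T.cutField β B r (k + 1) v| ≤
      β * ∑ v ∈ T.level r, T.pathSum β b k (fun u => (T.offspring u : ℝ)) v := by
    rw [level, Finset.sum_filter, Finset.mul_sum]
    refine Finset.sum_le_sum fun v hv => ?_
    rw [mem_upTo] at hv
    rw [cutField, cutField]
    split_ifs with h
    · rw [abs_of_nonneg (sub_nonneg.2 (cavity_le_cavity_plusField hβ k v (by omega)))]
      exact cavity_plusField_sub_le hβ hb k hB v hv.1 (by omega)
    · rw [plusField, if_neg (by omega)]
      simp
  have h1 := isingMean_sub_le hβ hH hH' hf1
  have h2 := mul_le_mul_of_nonneg_left hsum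
    (show (0 : ℝ) ≤ 4 * 2 ^ (T.upTo r).card by positivity)
  linarith

end WordTree

/-! ### Expectations of path sums -/

/-- A nonnegative sequence whose tails are bounded by a multiple of the preceding term decays
geometrically. -/
theorem ENNReal.le_geometric_of_tsum_le {a : ℕ → ℝ≥0∞} {M : ℝ≥0∞} (hM : M ≠ ∞)
    (h : ∀ n, ∑' k, a (n + (k + 1)) ≤ M * a n) (n : ℕ) :
    a n ≤ (1 + M) * (M / (1 + M)) ^ n * a 0 := by
  have h1 : 1 + M ≠ 0 := by simp
  have h2 : 1 + M ≠ ∞ := ENNReal.add_ne_top.2 ⟨ENNReal.one_ne_top, hM⟩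
  have hR : ∀ n, ∑' k, a (n + k) = a n + ∑' k, a (n + (k + 1)) := fun n =>
    tsum_eq_zero_add' ENNReal.summable
  have hstep : ∀ n, ∑' k, a (n + (k + 1)) ≤ M / (1 + M) * ∑' k, a (n + k) := by
    intro n
    rw [div_eq_mul_inv, mul_right_comm, ← div_eq_mul_inv,
      ENNReal.le_div_iff_mul_le (Or.inl h1) (Or.inl h2), mul_add, mul_one, hR n, mul_add,
      mul_comm _ M]
    exact add_le_add_left (h n) _
  have hind : ∀ n, ∑' k, a (n + k) ≤ (M / (1 + M)) ^ n * ∑' k, a (0 + k) := by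
    intro n
    induction n with
    | zero => simp
    | succ n ih =>
      have : ∑' k, a (n + 1 + k) = ∑' k, a (n + (k + 1)) := by
        congr 1; funext k; congr 1; ring
      rw [this, pow_succ', mul_assoc]
      exact (hstep n).trans (mul_le_mul_right ih _)
  calc a n ≤ ∑' k, a (n + k) := by rw [hR]; exact le_self_add
    _ ≤ (M / (1 + M)) ^ n * ∑' k, a (0 + k) := hind n
    _ ≤ (M / (1 + M)) ^ n * ((1 + M) * a 0) := by
      refine mul_le_mul_right ?_ _
      rw [hR 0, add_mul, one_mul]
      exact add_le_add_right (h 0) _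
    _ = _ := by ring

namespace WordTree

variable {Ω : Type*} [MeasurableSpace Ω] {T : Ω → WordTree}

theorem measurableSet_upTo_eq (hT : ∀ v, MeasurableSet {ω | v ∈ (T ω).carrier}) (n : ℕ)
    (τ : Finset (List ℕ)) : MeasurableSet {ω | (T ω).upTo n = τ} := by
  have : {ω | (T ω).upTo n = τ} =
      {ω | ∀ v : List ℕ, (v ∈ (T ω).carrier ∧ v.length ≤ n) ↔ v ∈ τ} := by
    ext ω
    simp only [Set.mem_ofPred_eq, Finset.ext_iff, mem_upTo]
  rw [this]
  refine measurableSet_setOfPred.2 (Measurable.forall fun v => Measurable.iff ?_ measurable_const)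
  exact (measurableSet_setOfPred.1 (hT v)).and measurable_const

/-- A quantity that depends on the tree only through its first `n` generations is measurable. -/
theorem measurable_of_upTo {α : Type*} [MeasurableSpace α]
    (hT : ∀ v, MeasurableSet {ω | v ∈ (T ω).carrier}) (n : ℕ) (g : WordTree → Ω → α)
    (hg : ∀ S S' : WordTree, S.upTo n = S'.upTo n → g S = g S') (hm : ∀ S, Measurable (g S)) :
    Measurable fun ω => g (T ω) ω := by
  intro s hs
  have : (fun ω => g (T ω) ω) ⁻¹' s =
      ⋃ τ : Finset (List ℕ), {ω | (T ω).upTo n = τ} ∩ {ω | g (T ω) ω ∈ s} := by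
    ext ω
    simp
  rw [this]
  refine MeasurableSet.iUnion fun τ => ?_
  by_cases hτ : ∃ ω₀, (T ω₀).upTo n = τ
  · obtain ⟨ω₀, rfl⟩ := hτ
    have : {ω | (T ω).upTo n = (T ω₀).upTo n} ∩ {ω | g (T ω) ω ∈ s} =
        {ω | (T ω).upTo n = (T ω₀).upTo n} ∩ g (T ω₀) ⁻¹' s := by
      ext ω
      simp only [Set.mem_inter_iff, Set.mem_ofPred_eq, Set.mem_preimage, and_congr_right_iff]
      intro h
      rw [hg _ _ h]
    rw [this]
    exact (measurableSet_upTo_eq hT n _).inter (hm _ hs)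
  · convert MeasurableSet.empty
    rw [Set.eq_empty_iff_forall_notMem]
    exact fun ω h => hτ ⟨ω, h.1⟩

theorem measurable_offspring (hT : ∀ v, MeasurableSet {ω | v ∈ (T ω).carrier}) (v : List ℕ) :
    Measurable fun ω => ((T ω).offspring v : ℝ) :=
  measurable_of_upTo hT (v.length + 1) (fun S _ => (S.offspring v : ℝ))
    (fun S S' h => by
      simp only [offspring_eq_card, children_eq_of_upTo_eq h (Nat.lt_succ_self _)])
    fun _ => measurable_const

theorem measurable_pathSum {S : WordTree} {β b : ℝ} {f : Ω → List ℕ → ℝ}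
    (hf : ∀ u, Measurable fun ω => f ω u) (n : ℕ) :
    ∀ v, Measurable fun ω => S.pathSum β b n (f ω) v := by
  induction n with
  | zero => exact hf
  | succ n ih =>
    exact fun v => Finset.measurable_sum _ fun a _ => (ih (a :: v)).const_mul _

/-- Path sums in a fixed tree are linear in the summand, and so commute with expectations. -/
theorem lintegral_pathSum_le (μ : Measure Ω) {S : WordTree} {β b : ℝ} (hβ : 0 ≤ β)
    {f : Ω → List ℕ → ℝ} (hf0 : ∀ ω u, 0 ≤ f ω u) (hf : ∀ u, Measurable fun ω => f ω u)
    {c : ℝ≥0∞} (n : ℕ) : ∀ v ∈ S.carrier,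
    (∀ u ∈ S.carrier, u.length = v.length + n → ∫⁻ ω, ENNReal.ofReal (f ω u) ∂μ ≤ c) →
    ∫⁻ ω, ENNReal.ofReal (S.pathSum β b n (f ω) v) ∂μ ≤
      ENNReal.ofReal (S.pathSum β b n (fun _ => 1) v) * c := by
  induction n with
  | zero =>
    intro v hv h
    simpa [pathSum] using h v hv rfl
  | succ n ih =>
    intro v hv h
    have e : ∀ g : List ℕ → ℝ, (∀ u, 0 ≤ g u) → ENNReal.ofReal (S.pathSum β b (n + 1) g v) =
        ∑ a ∈ S.children v, ENNReal.ofReal (edgeSlope β (S.cavity β (fun _ => b) n (a :: v))) *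
          ENNReal.ofReal (S.pathSum β b n g (a :: v)) := by
      intro g hg
      rw [pathSum, ENNReal.ofReal_sum_of_nonneg fun a _ =>
        mul_nonneg (edgeSlope_nonneg hβ _) (pathSum_nonneg hβ hg _ _)]
      exact Finset.sum_congr rfl fun a _ => ENNReal.ofReal_mul (edgeSlope_nonneg hβ _)
    have hm : ∀ a, Measurable fun ω => ENNReal.ofReal (S.pathSum β b n (f ω) (a :: v)) :=
      fun a => (measurable_pathSum hf n (a :: v)).ennreal_ofReal
    simp only [e _ (hf0 _), e (fun _ => 1) fun _ => zero_le_one]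
    rw [lintegral_finsetSum _ fun a _ => (hm a).const_mul _, Finset.sum_mul]
    refine Finset.sum_le_sum fun a ha => ?_
    rw [lintegral_const_mul _ (hm a), mul_assoc]
    refine mul_le_mul_right (ih (a :: v) (mem_children.1 ha) fun u hu hl => h u hu ?_) _
    rw [hl, List.length_cons]
    ring

theorem measurable_sum_level_pathSum (hT : ∀ v, MeasurableSet {ω | v ∈ (T ω).carrier})
    (W : Finset (List ℕ) → ℝ≥0∞) (β b : ℝ) (r n : ℕ) :
    Measurable fun ω => W ((T ω).upTo r) * ENNReal.ofReal
      (∑ v ∈ (T ω).level r, (T ω).pathSum β b n (fun _ => 1) v) :=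
  measurable_of_upTo hT (r + n) (fun S _ => W (S.upTo r) * ENNReal.ofReal
      (∑ v ∈ S.level r, S.pathSum β b n (fun _ => 1) v))
    (fun S S' h => by
      funext ω
      rw [upTo_eq_of_le h (Nat.le_add_right r n), level_eq_of_upTo_eq h (Nat.le_add_right r n)]
      congr 2
      exact Finset.sum_congr rfl fun v hv =>
        pathSum_eq_of_upTo_eq h n _ v (by rw [(mem_level.1 hv).2]))
    fun _ => measurable_const

theorem lintegral_eq_tsum_upTo (P : Measure Ω) (hT : ∀ v, MeasurableSet {ω | v ∈ (T ω).carrier})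
    (n : ℕ) (f : Ω → ℝ≥0∞) :
    ∫⁻ ω, f ω ∂P = ∑' τ : Finset (List ℕ), ∫⁻ ω in {ω | (T ω).upTo n = τ}, f ω ∂P := by
  rw [← lintegral_iUnion (measurableSet_upTo_eq hT n), ← setLIntegral_univ]
  · congr 2
    ext ω
    simp
  · intro τ τ' h
    exact Set.disjoint_left.2 fun ω h1 h2 => h (h1.symm.trans h2)

/-- Conditionally on the first `r + n` generations, the path sum is a linear function of the
offspring numbers at generation `r + n`, whose conditional means are at most `Δ`. -/
theorem lintegral_pathSum_offspring_le {P : Measure Ω} [IsProbabilityMeasure P] {Δ : ℝ}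
    (h : IsCondIndepTree P T Δ) (W : Finset (List ℕ) → ℝ≥0∞) {β : ℝ} (hβ : 0 ≤ β) (b : ℝ)
    (r n : ℕ) :
    ∫⁻ ω, W ((T ω).upTo r) * ENNReal.ofReal (∑ v ∈ (T ω).level r,
        (T ω).pathSum β b n (fun u => ((T ω).offspring u : ℝ)) v) ∂P ≤
      ENNReal.ofReal Δ * ∫⁻ ω, W ((T ω).upTo r) * ENNReal.ofReal (∑ v ∈ (T ω).level r,
        (T ω).pathSum β b n (fun _ => 1) v) ∂P := by
  have hT := h.measurableSet_mem
  rw [lintegral_eq_tsum_upTo P hT (r + n), lintegral_eq_tsum_upTo P hT (r + n),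
    ← ENNReal.tsum_mul_left]
  refine ENNReal.tsum_le_tsum fun τ => ?_
  by_cases hP : P {ω | (T ω).upTo (r + n) = τ} = 0
  · simp [Measure.restrict_eq_zero.2 hP]
  obtain ⟨ω₀, hω₀⟩ : ({ω | (T ω).upTo (r + n) = τ} : Set Ω).Nonempty :=
    Set.nonempty_iff_ne_empty.2 fun he => hP (by simp [he])
  have hE := measurableSet_upTo_eq hT (r + n) τ
  set E := {ω | (T ω).upTo (r + n) = τ} with hEdef
  have heq : ∀ ω ∈ E, ∀ f : List ℕ → ℝ,
      W ((T ω).upTo r) * ENNReal.ofReal (∑ v ∈ (T ω).level r, (T ω).pathSum β b n f v) =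
      W ((T ω₀).upTo r) *
        ENNReal.ofReal (∑ v ∈ (T ω₀).level r, (T ω₀).pathSum β b n f v) := by
    intro ω hω f
    have h' : (T ω).upTo (r + n) = (T ω₀).upTo (r + n) := hω.trans hω₀.symm
    rw [upTo_eq_of_le h' (Nat.le_add_right r n), level_eq_of_upTo_eq h' (Nat.le_add_right r n)]
    congr 2
    exact Finset.sum_congr rfl fun v hv =>
      pathSum_eq_of_upTo_eq h' n _ v (by rw [(mem_level.1 hv).2])
  have hmean : ∀ u ∈ (T ω₀).carrier, u.length = r + n →
      ∫⁻ ω in E, ENNReal.ofReal ((T ω).offspring u : ℝ) ∂P ≤ ENNReal.ofReal Δ * P E := by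
    intro u hu hl
    have hu' : u ∈ τ := by
      rw [← (show (T ω₀).upTo (r + n) = τ from hω₀), mem_upTo]
      exact ⟨hu, hl.le⟩
    have := h.mean_le (r + n) τ hP u hu' hl
    rw [ProbabilityTheory.cond, lintegral_smul_measure, smul_eq_mul, mul_comm, ← div_eq_mul_inv,
      ENNReal.div_le_iff hP (measure_ne_top P _)] at this
    simpa only [ENNReal.ofReal_natCast] using this
  rw [setLIntegral_congr_fun hE fun ω hω => heq ω hω _,
    setLIntegral_congr_fun hE fun ω hω => heq ω hω _, setLIntegral_const]
  have hoff := measurable_offspring hT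
  have hps : ∀ v, Measurable fun ω =>
      (T ω₀).pathSum β b n (fun u => ((T ω).offspring u : ℝ)) v := measurable_pathSum hoff n
  have hofs : ∀ g : List ℕ → ℝ, (∀ u, 0 ≤ g u) →
      ENNReal.ofReal (∑ v ∈ (T ω₀).level r, (T ω₀).pathSum β b n g v) =
      ∑ v ∈ (T ω₀).level r, ENNReal.ofReal ((T ω₀).pathSum β b n g v) := fun g hg =>
    ENNReal.ofReal_sum_of_nonneg fun v _ => pathSum_nonneg hβ hg n v
  rw [lintegral_const_mul _ (Finset.measurable_sum _ fun v _ => hps v).ennreal_ofReal,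
    hofs (fun _ => 1) fun _ => zero_le_one]
  simp only [hofs _ fun u => Nat.cast_nonneg ((T _).offspring u)]
  rw [lintegral_finsetSum _ fun v _ => (hps v).ennreal_ofReal,
    show ∀ a b c d : ℝ≥0∞, a * (b * c * d) = b * (c * (a * d)) by intros; ring]
  refine mul_le_mul_right ?_ _
  rw [Finset.sum_mul]
  refine Finset.sum_le_sum fun v hv => ?_
  rw [mem_level] at hv
  exact lintegral_pathSum_le _ hβ (fun ω u => Nat.cast_nonneg _) hoff n v hv.1
    fun u hu hl => hmean u hu (by rw [hl, hv.2])

/-- Expected path sums decay exponentially, also when they are weighted by a function of the first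
`r` generations. -/
theorem lintegral_pathSum_le_geometric {P : Measure Ω} [IsProbabilityMeasure P] {Δ : ℝ}
    (h : IsCondIndepTree P T Δ) (W : Finset (List ℕ) → ℝ≥0∞) {β b : ℝ} (hβ : 0 ≤ β) (hb : 0 < b)
    {M : ℝ≥0∞} (hM : M ≠ ∞) (hΔ : ENNReal.ofReal (β / b) * ENNReal.ofReal Δ ≤ M) (r n : ℕ) :
    ∫⁻ ω, W ((T ω).upTo r) * ENNReal.ofReal (∑ v ∈ (T ω).level r,
        (T ω).pathSum β b n (fun _ => 1) v) ∂P ≤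
      (1 + M) * (M / (1 + M)) ^ n *
        ∫⁻ ω, W ((T ω).upTo r) * ((T ω).level r).card ∂P := by
  have key := ENNReal.le_geometric_of_tsum_le (a := fun n => ∫⁻ ω, W ((T ω).upTo r) *
    ENNReal.ofReal (∑ v ∈ (T ω).level r, (T ω).pathSum β b n (fun _ => 1) v) ∂P) hM ?_ n
  · simpa [pathSum] using key
  intro n
  refine ENNReal.tsum_le_of_sum_range_le fun K => ?_
  have hm := measurable_sum_level_pathSum h.measurableSet_mem W β b r
  rw [← lintegral_finsetSum _ fun k _ => hm (n + (k + 1))]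
  calc _ ≤ ∫⁻ ω, ENNReal.ofReal (β / b) * (W ((T ω).upTo r) * ENNReal.ofReal
          (∑ v ∈ (T ω).level r, (T ω).pathSum β b n (fun u => ((T ω).offspring u : ℝ)) v)) ∂P := by
        refine lintegral_mono fun ω => ?_
        dsimp only
        rw [← Finset.mul_sum, ← ENNReal.ofReal_sum_of_nonneg fun k _ =>
            Finset.sum_nonneg fun v _ => pathSum_nonneg hβ (fun _ => zero_le_one) _ _,
          Finset.sum_comm, mul_left_comm, ← ENNReal.ofReal_mul (by positivity)]
        refine mul_le_mul_right (ENNReal.ofReal_le_ofReal ?_) _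
        rw [Finset.mul_sum]
        exact Finset.sum_le_sum fun v hv => sum_pathSum_add_le hβ hb n K (mem_level.1 hv).1
    _ = ENNReal.ofReal (β / b) * _ := lintegral_const_mul' _ _ ENNReal.ofReal_ne_top
    _ ≤ _ := mul_le_mul_right (lintegral_pathSum_offspring_le h W hβ b r n) _
    _ ≤ _ := by
        rw [← mul_assoc]
        exact mul_le_mul_left hΔ _

/-! ### Measurability of the correlation sum -/

theorem measurable_isingMean {β : ℝ} {B : Ω → List ℕ → ℝ} (hB : ∀ v, Measurable fun ω => B ω v)
    (S : Finset (List ℕ)) (f : (List ℕ → ℤˣ) → ℝ) :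
    Measurable fun ω => isingMean β (B ω) S f := by
  have hE : ∀ σ, Measurable fun ω => Real.exp (isingEnergy β (B ω) S σ) := fun σ =>
    (Finset.measurable_sum _ fun v _ => ((hB v).mul_const _).add_const _).exp
  exact (Finset.measurable_sum _ fun x _ => (hE _).const_mul _).div
    (Finset.measurable_sum _ fun x _ => hE _)

theorem measurable_corrSum (hT : ∀ v, MeasurableSet {ω | v ∈ (T ω).carrier}) (β : ℝ)
    {B : Ω → List ℕ → ℝ} (hB : ∀ v, Measurable fun ω => B ω v) {r l : ℕ} (hr : r ≤ l) :
    Measurable fun ω => (T ω).corrSum l r β (B ω) := by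
  simp only [corrSum_eq hr]
  refine measurable_of_upTo hT l (fun S ω => ∑ v ∈ S.level r, S.rootCov l β (B ω) v) ?_ ?_
  · intro S S' h
    funext ω
    simp only [level_eq_of_upTo_eq h hr, rootCov, h]
  · exact fun S => Finset.measurable_sum _ fun v _ => (measurable_isingMean hB _ _).sub
      ((measurable_isingMean hB _ _).mul (measurable_isingMean hB _ _))

end WordTree

/-! ### Exponential decay -/

theorem mainTheorem6 (βmax Bmax : ℝ) :
    ∃ C : ℝ, 0 < C ∧
      ∀ Bmin Δ : ℝ, 0 < Bmin → Bmin ≤ Bmax →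
        ∃ A lam : ℝ, 0 < A ∧ 0 < lam ∧
          ∀ (Ω : Type*) [MeasurableSpace Ω] (P : Measure Ω) [IsProbabilityMeasure P]
            (T : Ω → WordTree) (B : Ω → List ℕ → ℝ) (β : ℝ),
            IsCondIndepTree P T Δ →
            (∀ v : List ℕ, Measurable fun ω => B ω v) →
            0 ≤ β → β ≤ βmax →
            (∀ r ℓ : ℕ, r ≤ ℓ →
              (∀ᵐ ω ∂P, ∀ v ∈ (T ω).upTo ℓ, Bmin ≤ B ω v) →
              Integrable (fun ω => (T ω).corrSum ℓ r β (B ω)) P ∧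
              ∫ ω, (T ω).corrSum ℓ r β (B ω) ∂P ≤ A * Real.exp (-lam * (r : ℝ))) ∧
            (∀ r ℓ : ℕ, r < ℓ →
              (∀ᵐ ω ∂P, ∀ v ∈ (T ω).upTo ℓ, Bmin ≤ B ω v) →
              (∀ᵐ ω ∂P, ∀ v ∈ (T ω).upTo (ℓ - 1), B ω v ≤ Bmax) →
              ∀ U : Ω → Finset (List ℕ),
                (∀ s : Finset (List ℕ), MeasurableSet {ω | U ω = s}) →
                (∀ ω, U ω ⊆ (T ω).upTo r) →
                ∫⁻ ω, ENNReal.ofReal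
                    (finTV (spinMarginal ((T ω).plusIsing ℓ β (B ω)) (U ω))
                      (spinMarginal ((T ω).freeIsing ℓ β (B ω)) (U ω))) ∂P
                  ≤ ENNReal.ofReal (A * Real.exp (-lam * ((ℓ : ℝ) - (r : ℝ)))) *
                    ∫⁻ ω, ENNReal.ofReal C ^ ((T ω).upTo r).card ∂P) := by
  -- One factor `2 ^ |T(r)|` of `4 ^ |T(r)|` counts spin configurations, the other one bounds the
  -- number of vertices of generation `r`.
  refine ⟨4, by norm_num, fun Bmin Δ hb _ => ?_⟩
  -- The summand `1` only serves to keep the decay rate finite if `βmax` or `Δ` vanishes.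
  set M : ℝ := |βmax| / Bmin * |Δ| + 1 with hMdef
  have hM : 0 < M := by positivity
  set ρ : ℝ := M / (1 + M) with hρdef
  have hρ : 0 < ρ := by positivity
  have hρ1 : ρ < 1 := (div_lt_one (by positivity)).2 (by linarith)
  have hexp : ∀ n : ℕ, Real.exp (-(-Real.log ρ) * n) = ρ ^ n := fun n => by
    rw [neg_neg, mul_comm, Real.exp_nat_mul, Real.exp_log hρ]
  -- The factor `1 + M` suffices for the covariances. For the total variation distance, `1 / ρ` makes
  -- up for the path sums reaching only to generation `ℓ - 1`.
  refine ⟨(1 + M) * (1 + 2 * (|βmax| * |Δ|) / ρ), -Real.log ρ, by positivity,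
    neg_pos.2 (Real.log_neg hρ hρ1), ?_⟩
  intro Ω _ P _ T B β hT hB hβ hβmax
  have hβ' : β ≤ |βmax| := hβmax.trans (le_abs_self _)
  have hΔM : ENNReal.ofReal (β / Bmin) * ENNReal.ofReal Δ ≤ ENNReal.ofReal M := by
    rw [← ENNReal.ofReal_mul (by positivity)]
    refine ENNReal.ofReal_le_ofReal ?_
    have h1 : β / Bmin * Δ ≤ β / Bmin * |Δ| :=
      mul_le_mul_of_nonneg_left (le_abs_self _) (by positivity)
    have h2 : β / Bmin * |Δ| ≤ |βmax| / Bmin * |Δ| := by gcongr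
    linarith
  have hgeo : ∀ n : ℕ, (1 + ENNReal.ofReal M) * (ENNReal.ofReal M / (1 + ENNReal.ofReal M)) ^ n =
      ENNReal.ofReal ((1 + M) * ρ ^ n) := fun n => by
    rw [ENNReal.ofReal_mul (by positivity), ENNReal.ofReal_pow hρ.le, hρdef,
      ENNReal.ofReal_div_of_pos (by positivity), ENNReal.ofReal_add zero_le_one hM.le,
      ENNReal.ofReal_one]
  have hdecay := fun (W : Finset (List ℕ) → ℝ≥0∞) (r n : ℕ) =>
    WordTree.lintegral_pathSum_le_geometric hT W hβ hb ENNReal.ofReal_ne_top hΔM r n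
  simp only [hgeo] at hdecay
  have hA : 0 ≤ 2 * (|βmax| * |Δ|) / ρ := by positivity
  refine ⟨fun r l hr hBmin => ?_, fun r l hr hBmin _ U _ hU => ?_⟩
  · have hmem : ∀ᵐ ω ∂P, ∀ w ∈ (T ω).carrier, w.length ≤ l → Bmin ≤ B ω w := by
      filter_upwards [hBmin] with ω h w hw hl
      exact h w (((T ω).mem_upTo l w).2 ⟨hw, hl⟩)
    have hnn : ∀ ω, 0 ≤ (T ω).corrSum l r β (B ω) := fun ω => by
      rw [WordTree.corrSum_eq hr]
      refine Finset.sum_nonneg fun v hv => ?_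
      rw [WordTree.mem_level] at hv
      exact WordTree.rootCov_nonneg hβ l v hv.1 (hv.2.trans_le hr)
    have hmeas := WordTree.measurable_corrSum hT.measurableSet_mem β hB hr
    have hbound : ∫⁻ ω, ENNReal.ofReal ((T ω).corrSum l r β (B ω)) ∂P ≤
        ENNReal.ofReal ((1 + M) * ρ ^ r) := by
      have h1 := hdecay (fun _ => 1) 0 r
      simp only [WordTree.level_zero, Finset.sum_singleton, Finset.card_singleton, Nat.cast_one,
        one_mul, lintegral_one, measure_univ, mul_one] at h1
      refine (lintegral_mono_ae ?_).trans h1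
      filter_upwards [hmem] with ω h
      rw [WordTree.corrSum_eq hr]
      exact ENNReal.ofReal_le_ofReal (WordTree.sum_rootCov_le hβ hb h hr)
    have hint : Integrable (fun ω => (T ω).corrSum l r β (B ω)) P :=
      (lintegral_ofReal_ne_top_iff_integrable hmeas.aestronglyMeasurable
        (Filter.Eventually.of_forall hnn)).1 (hbound.trans_lt ENNReal.ofReal_lt_top).ne
    refine ⟨hint, ?_⟩
    rw [hexp, ← ENNReal.ofReal_le_ofReal_iff (by positivity),
      ofReal_integral_eq_lintegral_ofReal hint (Filter.Eventually.of_forall hnn)]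
    refine hbound.trans (ENNReal.ofReal_le_ofReal ?_)
    refine mul_le_mul_of_nonneg_right ?_ (by positivity)
    nlinarith
  · obtain ⟨k, rfl⟩ := Nat.exists_eq_add_of_lt hr
    have hcast : ((r + k + 1 : ℕ) : ℝ) - (r : ℝ) = ((k + 1 : ℕ) : ℝ) := by push_cast; ring
    rw [hcast, hexp]
    have h1 := WordTree.lintegral_pathSum_offspring_le hT (fun τ => 2 ^ τ.card) hβ Bmin r k
    have h2 := hdecay (fun τ => 2 ^ τ.card) r k
    calc _ ≤ ∫⁻ ω, ENNReal.ofReal (2 * β) * (2 ^ ((T ω).upTo r).card * ENNReal.ofReal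
            (∑ v ∈ (T ω).level r, (T ω).pathSum β Bmin k
              (fun u => ((T ω).offspring u : ℝ)) v)) ∂P := by
          refine lintegral_mono_ae ?_
          filter_upwards [hBmin] with ω h
          have hTV := WordTree.finTV_plusIsing_freeIsing_le hβ hb r k
            (fun w hw hl => h w (((T ω).mem_upTo _ w).2 ⟨hw, hl⟩)) (hU ω)
          refine (ENNReal.ofReal_le_ofReal hTV).trans_eq ?_
          rw [show ∀ x y z w : ℝ, x * y * (z * w) = x * z * (y * w) by intros; ring,
            ENNReal.ofReal_mul (by positivity),
            ENNReal.ofReal_mul (p := 2 ^ ((T ω).upTo r).card) (by positivity),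
            ENNReal.ofReal_pow zero_le_two, ENNReal.ofReal_ofNat]
      _ = ENNReal.ofReal (2 * β) * _ := lintegral_const_mul' _ _ ENNReal.ofReal_ne_top
      _ ≤ ENNReal.ofReal (2 * β) * (ENNReal.ofReal Δ * (ENNReal.ofReal ((1 + M) * ρ ^ k) *
            ∫⁻ ω, 2 ^ ((T ω).upTo r).card * (((T ω).level r).card : ℝ≥0∞) ∂P)) :=
          mul_le_mul_right (h1.trans (mul_le_mul_right h2 _)) _
      _ = ENNReal.ofReal (2 * β) * ENNReal.ofReal Δ * ENNReal.ofReal ((1 + M) * ρ ^ k) *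
            ∫⁻ ω, 2 ^ ((T ω).upTo r).card * (((T ω).level r).card : ℝ≥0∞) ∂P := by
          simp only [mul_assoc]
      _ ≤ _ := by
          refine mul_le_mul' ?_ (lintegral_mono fun ω => ?_)
          · rw [← ENNReal.ofReal_mul (by positivity), ← ENNReal.ofReal_mul' (by positivity)]
            refine ENNReal.ofReal_le_ofReal ?_
            have h3 : 2 * β * Δ ≤ 2 * (|βmax| * |Δ|) := by
              have h4 : β * Δ ≤ β * |Δ| := mul_le_mul_of_nonneg_left (le_abs_self _) hβ
              have h5 : β * |Δ| ≤ |βmax| * |Δ| := mul_le_mul_of_nonneg_right hβ' (abs_nonneg _)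
              linarith
            have h6 : 0 ≤ (1 + M) * ρ ^ k := by positivity
            calc _ ≤ 2 * (|βmax| * |Δ|) * ((1 + M) * ρ ^ k) := mul_le_mul_of_nonneg_right h3 h6
              _ = (1 + M) * (2 * (|βmax| * |Δ|) / ρ) * ρ ^ (k + 1) := by
                rw [pow_succ]
                field_simp
              _ ≤ _ := by gcongr; linarith
          · have hc : ((T ω).level r).card ≤ 2 ^ ((T ω).upTo r).card :=
              (Finset.card_le_card (WordTree.level_subset_upTo le_rfl)).trans Nat.lt_two_pow_self.le
            calc _ ≤ (2 : ℝ≥0∞) ^ ((T ω).upTo r).card * 2 ^ ((T ω).upTo r).card := by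
                  refine mul_le_mul_right ?_ _
                  exact_mod_cast hc
              _ = _ := by
                  rw [← mul_pow, ENNReal.ofReal_ofNat]
                  norm_num
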